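/- Consider quadrilaterals $P_0P_1P_2P_3$ in the Euclidean plane (simple, with labelled vertices in cyclic order, considered up to similarity), and label the side $P_iP_{i+1}$ by $i$ (indices modulo $4$). A diagonal $P_iP_{i+2}$ that splits the quadrilateral into two triangles determines four angle parameters $(a_1,a_2,a_3,a_4)$, namely the angles that this diagonal makes with the four sides: $$a_1=\angle P_{i+1}P_iP_{i+2},\quad a_2=\angle P_{i+1}P_{i+2}P_i,\quad a_3=\angle P_{i+3}P_{i+2}P_i,\quad a_4=\angle P_{i+3}P_iP_{i+2}.$$ For $\varepsilon>0$ the quadrilateral is called $\varepsilon$-near square if, for some such diagonal, $|a_j-\tfrac{\pi}{4}|<\varepsilon$ for all $j=1,2,3,4$. A billiard path is the trajectory of a ball that moves in straight lines inside the quadrilateral and is reflected at the sides (the angle of incidence equals the angle of reflection) without ever hitting a vertex. A nonempty word $W=w_1w_2\cdots w_n$ of even length $n$ in the letters $0,1,2,3$ is an orbit type of a periodic billiard path if the path closes up after $n$ bounces and successively hits the sides $w_1,\dots,w_n$. The orbit tile $O(W)$ is the set of all quadrilaterals that have a periodic billiard path with orbit type $W$. **Theorem.** The set of all $\frac{\pi}{107}$-near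 square quadrilaterals is covered by finitely many orbit tiles: there is a finite set $\mathcal W$ of words such that every $\frac{\pi}{107}$-near square quadrilateral lies in $O(W)$ for some $W\in\mathcal W$. In particular, every $\frac{\pi}{107}$-near square quadrilateral has a periodic billiard path. -/

import Mathlib

/-- The Euclidean plane. -/
abbrev Plane : Type := EuclideanSpace ℝ (Fin 2)

/-- For a cyclically ordered quadruple of points `P 0, P 1, P 2, P 3` (indices modulo `4`), the
segment from `P i` to `P (i + 2)` splits the figure into the two non-degenerate triangles
`P i, P (i + 1), P (i + 2)` and `P i, P (i + 2), P (i + 3)` lying on opposite sides of it. -/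
def IsSplittingDiagonal (P : Fin 4 → Plane) (i : Fin 4) : Prop :=
  P i ≠ P (i + 2) ∧ (line[ℝ, P i, P (i + 2)]).SOppSide (P (i + 1)) (P (i + 3))

/-- A (simple, not necessarily convex) quadrilateral in the plane with labelled vertices: two
non-degenerate triangles glued along a common side, the diagonal. Similar quadrilaterals are
not identified; all notions below are invariant under similarities. -/
structure Quadrilateral where
  /-- The vertices, in cyclic order. -/
  vertex : Fin 4 → Plane
  exists_diagonal : ∃ i, IsSplittingDiagonal vertex i

namespace Quadrilateral

/-- The billiard table: the closed region enclosed by the quadrilateral, that is, the union of the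
two triangles into which a splitting diagonal cuts it. (If both diagonals split the quadrilateral,
then it is convex and the two unions of triangles agree.) -/
def table (q : Quadrilateral) : Set Plane :=
  {p | ∃ i, IsSplittingDiagonal q.vertex i ∧
    (p ∈ convexHull ℝ {q.vertex i, q.vertex (i + 1), q.vertex (i + 2)} ∨
      p ∈ convexHull ℝ {q.vertex i, q.vertex (i + 2), q.vertex (i + 3)})}

/-- The relative interior of the side with label `w`, which joins the vertices `w` and `w + 1`. -/
def openSide (q : Quadrilateral) (w : Fin 4) : Set Plane :=
  openSegment ℝ (q.vertex w) (q.vertex (w + 1))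

/-- The direction vector of the side with label `w`. -/
def sideVector (q : Quadrilateral) (w : Fin 4) : Plane :=
  q.vertex (w + 1) - q.vertex w

/-- The four parameters of the quadrilateral with respect to the diagonal from vertex `i` to
vertex `i + 2`: the angles that this diagonal makes with the four sides. -/
noncomputable def angleParam (q : Quadrilateral) (i : Fin 4) : Fin 4 → ℝ :=
  ![EuclideanGeometry.angle (q.vertex (i + 1)) (q.vertex i) (q.vertex (i + 2)),
    EuclideanGeometry.angle (q.vertex (i + 1)) (q.vertex (i + 2)) (q.vertex i),
    EuclideanGeometry.angle (q.vertex (i + 3)) (q.vertex (i + 2)) (q.vertex i),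
    EuclideanGeometry.angle (q.vertex (i + 3)) (q.vertex i) (q.vertex (i + 2))]

/-- `q` is `ε`-near square: for some splitting diagonal, all four parameters are within `ε` of
`π / 4`. -/
def IsNearSquare (q : Quadrilateral) (ε : ℝ) : Prop :=
  ∃ i, IsSplittingDiagonal q.vertex i ∧ ∀ j, |q.angleParam i j - Real.pi / 4| < ε

end Quadrilateral

/-- The unit vector pointing from `p` to `p'` (for `p ≠ p'`). -/
noncomputable def unitDirection (p p' : Plane) : Plane := ‖p' - p‖⁻¹ • (p' - p)

namespace Quadrilateral

/-- A billiard path in `q`, given by its successive bouncing points `x k` and the labels `s k` of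
the sides that are hit. Every bouncing point is interior to its side (no vertex is hit), between
two bounces the ball moves along a segment inside the table, and the law of reflection holds: the
outgoing direction is the mirror image of the incoming direction in the side. -/
structure IsBilliardPath (q : Quadrilateral) (x : ℤ → Plane) (s : ℤ → Fin 4) : Prop where
  hits : ∀ k, x k ∈ q.openSide (s k)
  moves : ∀ k, x k ≠ x (k + 1)
  inside : ∀ k, openSegment ℝ (x k) (x (k + 1)) ⊆ interior q.table
  reflects : ∀ k, unitDirection (x k) (x (k + 1)) =
    (Submodule.span ℝ {q.sideVector (s k)}).reflection (unitDirection (x (k - 1)) (x k))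

/-- `q` has a periodic billiard path. -/
def HasPeriodicBilliardPath (q : Quadrilateral) : Prop :=
  ∃ (x : ℤ → Plane) (s : ℤ → Fin 4), q.IsBilliardPath x s ∧
    ∃ n : ℤ, 0 < n ∧ Function.Periodic x n ∧ Function.Periodic s n

/-- `q` has a periodic billiard path with orbit type `W`: `W` is a nonempty word of even length in
the side labels, the path closes up after `W.length` bounces, and `W` lists the sides hit during
these bounces. -/
def HasOrbitType (q : Quadrilateral) (W : List (Fin 4)) : Prop :=
  W ≠ [] ∧ Even W.length ∧
    ∃ (x : ℤ → Plane) (s : ℤ → Fin 4), q.IsBilliardPath x s ∧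
      Function.Periodic x (W.length : ℤ) ∧ Function.Periodic s (W.length : ℤ) ∧
      ∀ j : Fin W.length, s ((j : ℕ) : ℤ) = W.get j

end Quadrilateral

/-- The orbit tile of the orbit type `W`: the set of all quadrilaterals that have a periodic
billiard path with orbit type `W`. -/
def orbitTile (W : List (Fin 4)) : Set Quadrilateral := {q | q.HasOrbitType W}

/-! Write the interior angles as π/2 + d_i. The d_i are small and sum to zero, the figure is convex,
and its sides have nearly equal lengths. A closed trajectory is found by cases on the d_i
(`Quad.hasLoop`). If all d_i vanish, a path parallel to a side works. Otherwise some d_i is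
negative. If the opposite one is negative too, eight bounces around the diagonal between these
vertices close up (`Diag.hasLoop`). If not, the two neighbours sum to at most -d_i, so one of them
is at most -d_i/2. Then there is a trajectory that touches only the base, which joins these two
vertices, and the two sides adjacent to it. Such a ball is described by its direction θ relative to
the base and by the signed height y, in units of the base, at which its line passes over the foot of
the side just left. Reflection in a side preserves the distance of the line from the endpoints of
that side. Hence a crossing acts by (θ, y) ↦ (θ + 2d, y + sin θ), where d belongs to the arrival
vertex, and an extra bounce off the base negates θ and y + sin θ (`Corner.go_direct`,
`Corner.go_base`). The adjacent sides only have to be long enough, so a closed path amounts to a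
pattern in which certain partial sums of sines have prescribed signs. Let the two base angles be π/2
- a and π/2 + b. For b < 0 the Fagnano path works, and for b = 0 a path with six bounces. For 0 < b
≤ a/2 the patterns meet a side perpendicularly at both ends, so that the ball retraces its path. The
ranges 3b < a and 2b < a < 3b each have a pattern with an open interval of starting heights. These
intervals degenerate at a = 3b and a = 2b, where shorter paths take over. No loop needs more than 28
bounces. Doubling it makes the length even, and there are finitely many words of length at most 56,
so all of these can serve as the covering family. -/

/-! ### States of the ball, closed trajectories and orbit types -/

/-- A ball that has just bounced: its position, the direction of the side that it has hit, and its
outgoing direction. -/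
@[ext]
structure Ball where
  /-- The position. -/
  pos : Plane
  /-- The linear span of the direction of the side hit. -/
  wall : Submodule ℝ Plane
  /-- The outgoing direction. -/
  dir : Plane

/-- The side with label `w` of the closed polygon with vertices `P`. -/
def side (P : Fin 4 → Plane) (w : Fin 4) : Set Plane := openSegment ℝ (P w) (P (w + 1))

/-- The linear span of the direction of the side with label `w`. -/
def wall (P : Fin 4 → Plane) (w : Fin 4) : Submodule ℝ Plane :=
  Submodule.span ℝ {P (w + 1) - P w}

/-- The ball `σ` moves straight inside the region `R` to the state `σ'`, where it bounces off a side
of the polygon `P`. -/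
structure Bounce (R : Set Plane) (P : Fin 4 → Plane) (σ σ' : Ball) : Prop where
  norm_dir : ‖σ.dir‖ = 1
  moves : ∃ τ : ℝ, 0 < τ ∧ σ'.pos = σ.pos + τ • σ.dir
  inside : openSegment ℝ σ.pos σ'.pos ⊆ R
  hits : ∃ w, σ'.pos ∈ side P w ∧ σ'.wall = wall P w
  reflects : σ'.dir = σ'.wall.reflection σ.dir

/-- The state `σ'` is reached from `σ` after `n` bounces. -/
def Reach (R : Set Plane) (P : Fin 4 → Plane) : ℕ → Ball → Ball → Prop
  | 0, σ, σ' => σ = σ'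
  | n + 1, σ, σ' => ∃ ρ, Reach R P n σ ρ ∧ Bounce R P ρ σ'

/-- There is a closed billiard trajectory with at most `n` bounces. -/
def HasLoop (R : Set Plane) (P : Fin 4 → Plane) (n : ℕ) : Prop :=
  ∃ σ m, 0 < m ∧ m ≤ n ∧ Reach R P m σ σ

section Reach

variable {R : Set Plane} {P Q : Fin 4 → Plane} {σ ρ τ : Ball} {m n : ℕ}

theorem Bounce.reach (h : Bounce R P σ ρ) : Reach R P 1 σ ρ := ⟨σ, rfl, h⟩

theorem Reach.trans (h : Reach R P m σ ρ) (h' : Reach R P n ρ τ) : Reach R P (m + n) σ τ := by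
  induction n generalizing τ with
  | zero => cases h'; exact h
  | succ n ih =>
    obtain ⟨π, h₁, h₂⟩ := h'
    exact ⟨π, ih h₁, h₂⟩

/-- Every side of `Q` is a side of `P`. -/
def SidesOf (Q P : Fin 4 → Plane) : Prop :=
  ∀ w, ∃ w', side Q w = side P w' ∧ wall Q w = wall P w'

theorem Bounce.of_sidesOf (hQ : SidesOf Q P) (h : Bounce R Q σ ρ) : Bounce R P σ ρ := by
  refine ⟨h.norm_dir, h.moves, h.inside, ?_, h.reflects⟩
  obtain ⟨w, h₁, h₂⟩ := h.hits
  obtain ⟨w', h₃, h₄⟩ := hQ w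
  exact ⟨w', h₃ ▸ h₁, h₄ ▸ h₂⟩

theorem Reach.of_sidesOf (hQ : SidesOf Q P) (h : Reach R Q n σ ρ) : Reach R P n σ ρ := by
  induction n generalizing ρ with
  | zero => exact h
  | succ n ih =>
    obtain ⟨π, h₁, h₂⟩ := h
    exact ⟨π, ih h₁, h₂.of_sidesOf hQ⟩

theorem HasLoop.of_sidesOf (hQ : SidesOf Q P) (h : HasLoop R Q n) : HasLoop R P n := by
  obtain ⟨σ, m, h₁, h₂, h₃⟩ := h
  exact ⟨σ, m, h₁, h₂, h₃.of_sidesOf hQ⟩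

theorem HasLoop.mono (h : HasLoop R P m) (hmn : m ≤ n) : HasLoop R P n := by
  obtain ⟨σ, k, h₁, h₂, h₃⟩ := h
  exact ⟨σ, k, h₁, h₂.trans hmn, h₃⟩

theorem sidesOf_rotate (P : Fin 4 → Plane) (i : Fin 4) : SidesOf (fun j => P (j + i)) P := by
  intro w
  refine ⟨w + i, ?_, ?_⟩ <;> simp only [side, wall, add_right_comm]

theorem sidesOf_reflect (P : Fin 4 → Plane) (i : Fin 4) : SidesOf (fun j => P (i - j)) P := by
  intro w
  refine ⟨i - (w + 1), ?_, ?_⟩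
  · simp only [side]
    rw [openSegment_symm]
    congr 2
    abel
  · simp only [wall]
    rw [show i - (w + 1) + 1 = i - w by abel, ← neg_sub, ← Set.neg_singleton, Submodule.span_neg]

/-- The state of the ball when it passes the trajectory backwards. -/
noncomputable def Ball.rev (σ : Ball) : Ball := ⟨σ.pos, σ.wall, -σ.wall.reflection σ.dir⟩

/-- The ball lies on the side which is recorded as its wall. -/
def OnSide (P : Fin 4 → Plane) (σ : Ball) : Prop := ∃ w, σ.pos ∈ side P w ∧ σ.wall = wall P w

/-- The reversed state leaves along the negative of the incoming direction, so the segment is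
traversed backwards. The reversed bounce takes place at `σ`, and `h` does not tell whether that
point lies on a side. -/
theorem Bounce.rev (h : Bounce R P σ ρ) (hσ : OnSide P σ) : Bounce R P ρ.rev σ.rev := by
  have h₁ : ρ.rev.dir = -σ.dir := by
    simp [Ball.rev, h.reflects, Submodule.reflection_reflection]
  obtain ⟨τ, hτ, hm⟩ := h.moves
  refine ⟨by rw [h₁, norm_neg, h.norm_dir], ⟨τ, hτ, ?_⟩, ?_, hσ, ?_⟩
  · rw [h₁]; simp [Ball.rev, hm]
  · rw [openSegment_symm]; exact h.inside
  · rw [h₁]; simp [Ball.rev]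

theorem Reach.onSide (h : Reach R P n σ ρ) (hσ : OnSide P σ) : OnSide P ρ := by
  cases n with
  | zero => cases h; exact hσ
  | succ n => obtain ⟨π, -, h⟩ := h; exact h.hits

theorem Reach.rev (h : Reach R P n σ ρ) (hσ : OnSide P σ) : Reach R P n ρ.rev σ.rev := by
  induction n generalizing ρ with
  | zero => cases h; rfl
  | succ n ih =>
    obtain ⟨π, h₁, h₂⟩ := h
    have := (h₂.rev (h₁.onSide hσ)).reach.trans (ih h₁)
    rwa [add_comm] at this

/-- A trajectory that starts and ends perpendicularly to a side is part of a closed one. -/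
theorem Reach.hasLoop_of_rev (h : Reach R P n σ ρ) (hn : 0 < n) (hσ : OnSide P σ)
    (h₁ : σ.rev = σ) (h₂ : ρ.rev = ρ) : HasLoop R P (n + n) := by
  have := h.rev hσ
  rw [h₁, h₂] at this
  exact ⟨σ, n + n, by lia, le_rfl, h.trans this⟩

theorem Reach.exists_seq (h : Reach R P n σ ρ) :
    ∃ f : ℕ → Ball, f 0 = σ ∧ f n = ρ ∧ ∀ i < n, Bounce R P (f i) (f (i + 1)) := by
  induction n generalizing ρ with
  | zero => exact ⟨fun _ => σ, rfl, h, by simp⟩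
  | succ n ih =>
    obtain ⟨π, h₁, h₂⟩ := h
    obtain ⟨f, hf0, hfn, hf⟩ := ih h₁
    refine ⟨fun i => if i ≤ n then f i else ρ, by simp [hf0], by simp, fun i hi => ?_⟩
    rcases Nat.lt_succ_iff_lt_or_eq.1 hi with hi | rfl
    · simpa [hi.le, Nat.succ_le_of_lt hi] using hf i hi
    · simpa [hfn] using h₂

theorem HasLoop.exists_periodic (h : HasLoop R P n) :
    ∃ (m : ℕ) (F : ℤ → Ball), 0 < m ∧ m ≤ n ∧ Function.Periodic F m ∧
      ∀ k, Bounce R P (F k) (F (k + 1)) := by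
  obtain ⟨σ, m, hm, hmn, h⟩ := h
  obtain ⟨f, hf0, hfm, hf⟩ := h.exists_seq
  have hm' : (0 : ℤ) < m := by exact_mod_cast hm
  refine ⟨m, fun k => f (k % m).toNat, hm, hmn, fun k => by simp, fun k => ?_⟩
  have h0 := Int.emod_nonneg k hm'.ne'
  have h1 := Int.emod_lt_of_pos k hm'
  have h2 := hf (k % m).toNat (by lia)
  have h3 : f ((k % m).toNat + 1) = f ((k + 1) % m).toNat := by
    rcases eq_or_ne (k % m + 1) m with h | h
    · have : (k + 1) % m = 0 := by
        rw [← Int.emod_add_emod, h, Int.emod_self]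
      rw [this, show (k % m).toNat + 1 = m by lia, hfm, Int.toNat_zero, hf0]
    · have : (k + 1) % m = k % m + 1 := by
        rw [← Int.emod_add_emod, Int.emod_eq_of_lt (by lia) (by lia)]
      rw [this]
      congr 1
      lia
  rw [h3] at h2
  exact h2

end Reach

open Classical in
/-- A closed billiard trajectory with at most `n` bounces yields, possibly after doubling it, an
orbit type of length at most `2 * n`. -/
theorem HasLoop.exists_hasOrbitType {q : Quadrilateral} {n : ℕ}
    (h : HasLoop (interior q.table) q.vertex n) :
    ∃ W : List (Fin 4), W.length ≤ 2 * n ∧ q.HasOrbitType W := by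
  obtain ⟨m, F, hm, hmn, hF, hb⟩ := h.exists_periodic
  -- The label is chosen as a function of the state alone, so the labels inherit the period of the
  -- states.
  let lab : Ball → Fin 4 := fun σ =>
    if h : OnSide q.vertex σ then h.choose else 0
  have hlab : ∀ k, (F k).pos ∈ side q.vertex (lab (F k)) ∧
      (F k).wall = wall q.vertex (lab (F k)) := by
    intro k
    have h : OnSide q.vertex (F k) := by
      have := (hb (k - 1)).hits
      rwa [sub_add_cancel] at this
    simp only [lab, dif_pos h]
    exact h.choose_spec
  have hdir : ∀ k, unitDirection (F k).pos (F (k + 1)).pos = (F k).dir := by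
    intro k
    obtain ⟨τ, hτ, hmv⟩ := (hb k).moves
    rw [unitDirection, hmv, add_sub_cancel_left, norm_smul, (hb k).norm_dir, Real.norm_eq_abs,
      abs_of_pos hτ, mul_one, smul_smul, inv_mul_cancel₀ hτ.ne', one_smul]
  -- An orbit type has even length, whereas `m` may be odd (the Fagnano path has three bounces).
  have h2m : Function.Periodic F ((2 * m : ℕ) : ℤ) := by
    have := hF.int_mul 2
    simpa using this
  let W : List (Fin 4) := List.ofFn fun j : Fin (2 * m) => lab (F ((j : ℕ) : ℤ))
  have hW : W.length = 2 * m := by simp [W]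
  refine ⟨W, by lia, ?_, by rw [hW]; exact even_two_mul m, fun k => (F k).pos,
    fun k => lab (F k), ⟨fun k => (hlab k).1, fun k hk => ?_, fun k => (hb k).inside, fun k => ?_⟩,
    ?_, ?_, ?_⟩
  · intro h0
    rw [h0] at hW
    simp at hW
    lia
  · have := hdir k
    rw [unitDirection, ← hk, sub_self, smul_zero] at this
    have h1 := (hb k).norm_dir
    rw [← this, norm_zero] at h1
    exact zero_ne_one h1
  · have h1 := (hb (k - 1)).reflects
    have h2 := hdir (k - 1)
    rw [sub_add_cancel] at h1 h2
    rw [hdir, h2, h1]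
    have h3 := (hlab k).2
    simp only [wall] at h3
    simp only [Quadrilateral.sideVector]
    congr! 
  · rw [hW]; exact fun k => by simp only [h2m k]
  · rw [hW]; exact fun k => by simp only [h2m k]
  · intro j
    simp [W]

theorem Quadrilateral.HasOrbitType.hasPeriodicBilliardPath {q : Quadrilateral} {W : List (Fin 4)}
    (h : q.HasOrbitType W) : q.HasPeriodicBilliardPath := by
  obtain ⟨hW, -, x, s, hp, hx, hs, -⟩ := h
  exact ⟨x, s, hp, W.length, by exact_mod_cast List.length_pos_iff.2 hW, hx, hs⟩

/-! ### Frames, direction angles and heights of lines over vertices -/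

/-- An orthonormal frame of the plane, of either orientation. -/
abbrev Frame : Type := Plane ≃ₗᵢ[ℝ] ℂ

/-- The cross product with respect to the orientation of the frame `F`. -/
noncomputable def cr (F : Frame) (u v : Plane) : ℝ := (F u).re * (F v).im - (F u).im * (F v).re

/-- The height of the point `z` over the line through the origin with direction angle `θ`. -/
noncomputable def hgt (θ : ℝ) (z : ℂ) : ℝ := Real.cos θ * z.im - Real.sin θ * z.re

/-- The polygon `P` is convex and runs counterclockwise in the frame `F`. -/
def CCW (F : Frame) (P : Fin 4 → Plane) : Prop :=
  ∀ w, 0 < cr F (P (w + 1) - P w) (P (w + 2) - P w)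

/-- All chords between different sides of `P` run inside `R`. -/
def Chords (R : Set Plane) (P : Fin 4 → Plane) : Prop :=
  ∀ w w', w ≠ w' → ∀ x ∈ side P w, ∀ y ∈ side P w', openSegment ℝ x y ⊆ R

/-- The ball `σ` has just bounced off side `w` and leaves it with direction angle `θ`; its line of
motion passes at signed height `η` over the vertex `v`. -/
structure At (F : Frame) (P : Fin 4 → Plane) (w : Fin 4) (θ : ℝ) (v : Fin 4) (η : ℝ)
    (σ : Ball) : Prop where
  mem : σ.pos ∈ side P w
  wall_eq : σ.wall = wall P w
  dir : F σ.dir = ⟨Real.cos θ, Real.sin θ⟩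
  inward : 0 < cr F (P (w + 1) - P w) σ.dir
  height : cr F σ.dir (σ.pos - P v) = η

section Strike

variable {F : Frame} {R : Set Plane} {P : Fin 4 → Plane} {σ : Ball} {v w w' : Fin 4}
  {θ η ω r : ℝ}

/-- `CCW` gives the vertex `w + 2` directly. For `w + 3` the orientation of a triangle is invariant
under cyclic permutation of its corners. -/
theorem CCW.pos (hP : CCW F P) (h₁ : v ≠ w) (h₂ : v ≠ w + 1) :
    0 < cr F (P (w + 1) - P w) (P v - P w) := by
  have h : v = w + 2 ∨ v = w + 3 := by
    clear hP; revert h₁ h₂; revert v w; decide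
  rcases h with rfl | rfl
  · exact hP w
  · have := hP (w + 3)
    have e1 : w + 3 + 1 = w := (by decide : ∀ w : Fin 4, w + 3 + 1 = w) w
    have e2 : w + 3 + 2 = w + 1 := (by decide : ∀ w : Fin 4, w + 3 + 2 = w + 1) w
    rw [e1, e2] at this
    simp only [cr, map_sub, Complex.sub_re, Complex.sub_im] at this ⊢
    linarith

theorem norm_of_frame_eq {u : Plane} (h : F u = ⟨Real.cos θ, Real.sin θ⟩) : ‖u‖ = 1 := by
  rw [← F.norm_map, h, Complex.norm_def, Complex.normSq_mk, ← sq, ← sq, Real.cos_sq_add_sin_sq,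
    Real.sqrt_one]

theorem frame_reflection {s u : Plane} (hr : r ≠ 0)
    (hs : F s = ⟨r * Real.cos ω, r * Real.sin ω⟩) (hu : F u = ⟨Real.cos θ, Real.sin θ⟩) :
    F ((Submodule.span ℝ {s}).reflection u) =
      ⟨Real.cos (2 * ω - θ), Real.sin (2 * ω - θ)⟩ := by
  have hn : ‖s‖ ^ 2 = r ^ 2 := by
    rw [← F.norm_map, hs, Complex.sq_norm, Complex.normSq_mk]
    linear_combination r ^ 2 * Real.cos_sq_add_sin_sq ω
  have hi : inner ℝ s u = r * Real.cos (ω - θ) := by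
    rw [← F.inner_map_map, hs, hu, Complex.inner, Real.cos_sub]
    simp
    ring
  rw [Submodule.reflection_singleton_apply, hi]
  have hc : (r * Real.cos (ω - θ)) / ((‖s‖ : ℝ) : ℝ) ^ 2 = Real.cos (ω - θ) / r := by
    rw [hn]; field_simp
  simp only [RCLike.ofReal_real_eq_id, id]
  rw [hc, two_nsmul, map_sub, map_add, map_smul, hs, hu]
  have e1 : 2 * ω - θ = ω + (ω - θ) := by ring
  have e2 := Real.cos_sub ω (ω - θ)
  have e3 := Real.sin_sub ω (ω - θ)
  rw [sub_sub_cancel] at e2 e3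
  apply Complex.ext
  · simp only [Complex.sub_re, Complex.add_re, Complex.smul_re, smul_eq_mul]
    rw [e1, Real.cos_add, e2]
    field_simp
    ring
  · simp only [Complex.sub_im, Complex.add_im, Complex.smul_im, smul_eq_mul]
    rw [e1, Real.sin_add, e3]
    field_simp
    ring

theorem cr_side (x : Plane) (hx : x ∈ side P w) (y : Plane) :
    cr F (P (w + 1) - P w) (y - x) = cr F (P (w + 1) - P w) (y - P w) := by
  obtain ⟨a, b, -, -, hab, rfl⟩ := hx
  obtain rfl : a = 1 - b := by linarith
  simp only [cr, map_sub, map_add, map_smul, Complex.sub_re, Complex.sub_im, Complex.add_re,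
    Complex.add_im, Complex.smul_re, Complex.smul_im, smul_eq_mul]
  ring

/-- Two different sides share at most one vertex, so an endpoint of side `w'` lies strictly inside
the line of side `w`, and the other one at least weakly. -/
theorem CCW.cr_pos (hP : CCW F P) (hw : w' ≠ w) {y : Plane} (hy : y ∈ side P w') :
    0 < cr F (P (w + 1) - P w) (y - P w) := by
  have key : ∀ v, 0 ≤ cr F (P (w + 1) - P w) (P v - P w) := by
    intro v
    rcases eq_or_ne v w with rfl | h₁
    · simp [cr]
    rcases eq_or_ne v (w + 1) with rfl | h₂
    · simp [cr, mul_comm]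
    exact (hP.pos h₁ h₂).le
  have h : (w' ≠ w ∧ w' ≠ w + 1) ∨ (w' + 1 ≠ w ∧ w' + 1 ≠ w + 1) := by
    clear hy hP key; revert hw; revert w w'; decide
  obtain ⟨a, b, ha, hb, hab, rfl⟩ := hy
  have e : cr F (P (w + 1) - P w) (a • P w' + b • P (w' + 1) - P w) =
      a * cr F (P (w + 1) - P w) (P w' - P w) + b * cr F (P (w + 1) - P w) (P (w' + 1) - P w) := by
    obtain rfl : a = 1 - b := by linarith
    simp only [cr, map_sub, map_add, map_smul, Complex.sub_re, Complex.sub_im, Complex.add_re,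
      Complex.add_im, Complex.smul_re, Complex.smul_im, smul_eq_mul]
    ring
  rw [e]
  rcases h with h | h
  · exact add_pos_of_pos_of_nonneg (mul_pos ha (hP.pos h.1 h.2)) (mul_nonneg hb.le (key _))
  · exact add_pos_of_nonneg_of_pos (mul_nonneg ha.le (key _)) (mul_pos hb (hP.pos h.1 h.2))

theorem At.height_vertex (h : At F P w θ v η σ) (v' : Fin 4) :
    cr F σ.dir (σ.pos - P v') = η + hgt θ (F (P v - P v')) := by
  rw [← h.height]
  simp only [cr, h.dir, hgt, map_sub, Complex.sub_re, Complex.sub_im]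
  ring

/-- A ball whose line of motion separates the endpoints of another side bounces off this side. -/
theorem At.strike (hP : CCW F P) (hR : Chords R P) (h : At F P w θ v η σ) (hw : w' ≠ w)
    (hr : 0 < r) (hs : F (P (w' + 1) - P w') = ⟨r * Real.cos ω, r * Real.sin ω⟩)
    (h₁ : 0 < η + hgt θ (F (P v - P w'))) (h₂ : η + hgt θ (F (P v - P (w' + 1))) < 0) :
    ∃ σ', Bounce R P σ σ' ∧ ∀ v', v' = w' ∨ v' = w' + 1 →
      At F P w' (2 * ω - θ) v' (-(η + hgt θ (F (P v - P v')))) σ' := by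
  set α := η + hgt θ (F (P v - P w')) with hα
  set β := η + hgt θ (F (P v - P (w' + 1))) with hβ
  have hαβ : 0 < α - β := by linarith
  have hαβ' : α - β ≠ 0 := hαβ.ne'
  -- The height of the line is affine along the side, with the values `α` and `β` at its ends. This
  -- is its zero.
  set y : Plane := (-β / (α - β)) • P w' + (α / (α - β)) • P (w' + 1) with hy
  have hys : y ∈ side P w' := by
    refine ⟨-β / (α - β), α / (α - β), div_pos (by linarith) hαβ, div_pos h₁ hαβ, ?_, rfl⟩
    field_simp
    ring
  have hA := h.height_vertex w'
  have hB := h.height_vertex (w' + 1)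
  rw [← hα] at hA
  rw [← hβ] at hB
  have hcr0 : cr F σ.dir (σ.pos - y) = 0 := by
    have : cr F σ.dir (σ.pos - y) = (-β / (α - β)) * cr F σ.dir (σ.pos - P w') +
        (α / (α - β)) * cr F σ.dir (σ.pos - P (w' + 1)) := by
      have e : (-β / (α - β)) = 1 - α / (α - β) := by field_simp; ring
      rw [hy, e]
      simp only [cr, map_sub, map_add, map_smul, Complex.sub_re, Complex.sub_im, Complex.add_re,
        Complex.add_im, Complex.smul_re, Complex.smul_im, smul_eq_mul]
      ring
    rw [this, hA, hB]
    field_simp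
    ring
  set τ := Real.cos θ * (F (y - σ.pos)).re + Real.sin θ * (F (y - σ.pos)).im with hτ
  have hyτ : y - σ.pos = τ • σ.dir := by
    apply F.injective
    have h0 : Real.cos θ * (F (y - σ.pos)).im - Real.sin θ * (F (y - σ.pos)).re = 0 := by
      have := hcr0
      simp only [cr, h.dir, map_sub, Complex.sub_re, Complex.sub_im] at this ⊢
      linarith
    rw [map_smul, h.dir]
    have hcs := Real.cos_sq_add_sin_sq θ
    apply Complex.ext
    · simp only [Complex.smul_re, smul_eq_mul, hτ]
      linear_combination (-(F (y - σ.pos)).re) * hcs - Real.sin θ * h0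
    · simp only [Complex.smul_im, smul_eq_mul, hτ]
      linear_combination (-(F (y - σ.pos)).im) * hcs + Real.cos θ * h0
  -- The hit lies ahead of the ball, since both the direction of motion and the point `y` are on the
  -- inner side of the line through side `w`.
  have hτ0 : 0 < τ := by
    have h3 := hP.cr_pos hw hys
    rw [← cr_side σ.pos h.mem y, hyτ] at h3
    have h4 : cr F (P (w + 1) - P w) (τ • σ.dir) = τ * cr F (P (w + 1) - P w) σ.dir := by
      simp only [cr, map_smul, Complex.smul_re, Complex.smul_im, smul_eq_mul]
      ring
    rw [h4] at h3
    exact pos_of_mul_pos_left h3 h.inward.le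
  have hrefl := frame_reflection hr.ne' hs h.dir
  have hsin : r * Real.sin (ω - θ) = α - β := by
    rw [← hA, ← hB, Real.sin_sub]
    have e1 := congrArg Complex.re hs
    have e2 := congrArg Complex.im hs
    simp only [map_sub, Complex.sub_re, Complex.sub_im] at e1 e2
    simp only [cr, h.dir, map_sub, Complex.sub_re, Complex.sub_im]
    linear_combination Real.sin θ * e1 - Real.cos θ * e2
  refine ⟨⟨y, wall P w', (wall P w').reflection σ.dir⟩,
    ⟨norm_of_frame_eq h.dir, ⟨τ, hτ0, ?_⟩, hR w w' hw.symm _ h.mem _ hys, ⟨w', hys, rfl⟩, rfl⟩,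
    fun v' hv' => ⟨hys, rfl, hrefl, ?_, ?_⟩⟩
  · rw [← hyτ]; abel
  · simp only [cr, hs, wall, hrefl]
    rw [← hsin] at hαβ
    calc 0 < r * Real.sin (ω - θ) := hαβ
      _ = _ := by
        rw [show ω - θ = (2 * ω - θ) - ω by ring, Real.sin_sub]
        ring
  · have h5 := h.height_vertex v'
    rw [← h5]
    have h6 : ∃ k : ℝ, y - P v' = k • (P (w' + 1) - P w') := by
      have e : (-β / (α - β)) = 1 - α / (α - β) := by field_simp; ring
      rcases hv' with rfl | rfl
      · exact ⟨α / (α - β), by rw [hy, e]; module⟩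
      · exact ⟨α / (α - β) - 1, by rw [hy, e]; module⟩
    obtain ⟨k, hk⟩ := h6
    have h7 : cr F σ.dir (σ.pos - P v') = cr F σ.dir (y - P v') := by
      have := hcr0
      simp only [cr, map_sub, Complex.sub_re, Complex.sub_im] at this ⊢
      linarith
    rw [h7]
    show cr F ((wall P w').reflection σ.dir) (y - P v') = _
    rw [hk]
    simp only [cr, wall, hrefl, h.dir, map_smul, hs, Complex.smul_re, Complex.smul_im, smul_eq_mul]
    have e1 := Real.sin_sub ω (2 * ω - θ)
    have e2 := Real.sin_sub ω θ
    have e3 : ω - (2 * ω - θ) = -(ω - θ) := by ring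
    rw [e3, Real.sin_neg] at e1
    linear_combination (-k * r) * e1 - k * r * e2

/-- The side, the direction and the height determine the state. -/
theorem At.unique {σ' : Ball} (h : At F P w θ v η σ) (h' : At F P w θ v η σ') : σ = σ' := by
  have hd : σ.dir = σ'.dir := F.injective (h.dir.trans h'.dir.symm)
  have hw : σ.wall = σ'.wall := h.wall_eq.trans h'.wall_eq.symm
  have hp : σ.pos = σ'.pos := by
    obtain ⟨a, b, -, -, hab, h1⟩ := h.mem
    obtain ⟨c, d, -, -, hcd, h2⟩ := h'.mem
    obtain rfl : a = 1 - b := by linarith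
    obtain rfl : c = 1 - d := by linarith
    have e := h.height.trans h'.height.symm
    have hi := h.inward
    rw [← hd, ← h1, ← h2] at e
    have : (b - d) * cr F (P (w + 1) - P w) σ.dir = 0 := by
      simp only [cr, map_sub, map_add, map_smul, Complex.sub_re, Complex.sub_im, Complex.add_re,
        Complex.add_im, Complex.smul_re, Complex.smul_im, smul_eq_mul] at e ⊢
      linarith
    rcases mul_eq_zero.1 this with h0 | h0
    · rw [← h1, ← h2, show b = d by linarith]
    · exact absurd h0 hi.ne'
  cases σ; cases σ'; simp_all

/-- Along side `w` the height over `P (w + 1)` runs linearly from 0 up to the given bound, so every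
value in between is attained. -/
theorem exists_ball_at (h₀ : 0 < η) (h₁ : η < hgt θ (F (P w - P (w + 1)))) :
    ∃ σ, At F P w θ (w + 1) η σ := by
  set m := hgt θ (F (P w - P (w + 1))) with hm
  have hm0 : 0 < m := h₀.trans h₁
  simp only [hgt, map_sub, Complex.sub_re, Complex.sub_im] at hm
  refine ⟨⟨(η / m) • P w + (1 - η / m) • P (w + 1), wall P w,
    F.symm ⟨Real.cos θ, Real.sin θ⟩⟩, ⟨?_, rfl, by simp, ?_, ?_⟩⟩
  · exact ⟨_, _, div_pos h₀ hm0, by rwa [sub_pos, div_lt_one hm0], by ring, rfl⟩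
  · simp only [cr, LinearIsometryEquiv.apply_symm_apply, map_sub, Complex.sub_re, Complex.sub_im]
    linarith
  · simp only [cr, LinearIsometryEquiv.apply_symm_apply, map_sub, map_add, map_smul,
      Complex.sub_re, Complex.sub_im, Complex.add_re, Complex.add_im, Complex.smul_re,
      Complex.smul_im, smul_eq_mul]
    have : (η / m) * m = η := div_mul_cancel₀ _ hm0.ne'
    linear_combination this - (η / m) * hm

end Strike

/-! ### Mirror images and composition of runs -/

/-- The frame with the opposite orientation. -/
noncomputable def Frame.mirror (F : Frame) : Frame :=
  F.trans (Complex.conjLIE.trans (LinearIsometryEquiv.neg ℝ))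

theorem Frame.mirror_apply (F : Frame) (v : Plane) : F.mirror v = ⟨-(F v).re, (F v).im⟩ := by
  apply Complex.ext <;> simp [Frame.mirror]

theorem Frame.mirror_mirror (F : Frame) : F.mirror.mirror = F := by
  ext v
  simp [Frame.mirror_apply]

theorem cr_mirror (F : Frame) (u v : Plane) : cr F.mirror u v = -cr F u v := by
  simp only [cr, Frame.mirror_apply]
  ring

theorem CCW.reflect {F : Frame} {P : Fin 4 → Plane} (h : CCW F P) (i : Fin 4) :
    CCW F.mirror fun j => P (i - j) := by
  intro w
  have h1 := h (i - w - 2)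
  have e1 : i - w - 2 + 1 = i - (w + 1) := by
    have : (2 : Fin 4) = 1 + 1 := rfl
    rw [this]; abel
  have e2 : i - w - 2 + 2 = i - w := by abel
  have e3 : i - (w + 2) = i - w - 2 := by abel
  rw [e1, e2] at h1
  simp only [e3, cr_mirror]
  simp only [cr, map_sub, Complex.sub_re, Complex.sub_im] at h1 ⊢
  linarith

/-- Reversing the cyclic order together with the orientation keeps the polygon counterclockwise. It
lets a ball travelling from right to left be described like one travelling from left to right. -/
theorem At.reflect {F : Frame} {P : Fin 4 → Plane} {w v : Fin 4} {θ η : ℝ} {σ : Ball}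
    (h : At F P w θ v η σ) (i : Fin 4) :
    At F.mirror (fun j => P (i - j)) (i - (w + 1)) (Real.pi - θ) (i - v) (-η) σ := by
  have e1 : i - (i - (w + 1)) = w + 1 := by abel
  have e2 : i - (i - (w + 1) + 1) = w := by abel
  have e3 : i - (i - v) = v := by abel
  refine ⟨?_, ?_, ?_, ?_, ?_⟩
  · have := h.mem
    simp only [side, e1, e2] at this ⊢
    rwa [openSegment_symm]
  · have := h.wall_eq
    simp only [wall, e1, e2] at this ⊢
    rw [this, ← neg_sub, ← Set.neg_singleton, Submodule.span_neg]
  · simp [Frame.mirror_apply, h.dir]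
  · have := h.inward
    simp only [e1, e2, cr_mirror]
    simp only [cr, map_sub, Complex.sub_re, Complex.sub_im] at this ⊢
    linarith
  · simp only [e3, cr_mirror, h.height]

/-- Every state with property `T` leads to one with property `T'` after `n` bounces. -/
def Go (R : Set Plane) (P : Fin 4 → Plane) (n : ℕ) (T T' : Ball → Prop) : Prop :=
  ∀ σ, T σ → ∃ σ', Reach R P n σ σ' ∧ T' σ'

theorem Go.trans {R : Set Plane} {P : Fin 4 → Plane} {m n : ℕ} {T₁ T₂ T₃ : Ball → Prop}
    (h : Go R P m T₁ T₂) (h' : Go R P n T₂ T₃) : Go R P (m + n) T₁ T₃ := by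
  intro σ hσ
  obtain ⟨ρ, h₁, h₂⟩ := h σ hσ
  obtain ⟨τ, h₃, h₄⟩ := h' ρ h₂
  exact ⟨τ, h₁.trans h₃, h₄⟩

theorem Go.of_sidesOf {R : Set Plane} {P Q : Fin 4 → Plane} {n : ℕ} {T₁ T₂ : Ball → Prop}
    (hQ : SidesOf Q P) (h : Go R Q n T₁ T₂) : Go R P n T₁ T₂ := by
  intro σ hσ
  obtain ⟨ρ, h₁, h₂⟩ := h σ hσ
  exact ⟨ρ, h₁.of_sidesOf hQ, h₂⟩

theorem Chords.of_sidesOf_reflect {R : Set Plane} {P : Fin 4 → Plane} (h : Chords R P)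
    (i : Fin 4) : Chords R fun j => P (i - j) := by
  intro w w' hw x hx y hy
  have key : ∀ w, side (fun j => P (i - j)) w = side P (i - (w + 1)) := by
    intro w
    simp only [side]
    rw [openSegment_symm]
    congr 2
    abel
  rw [key] at hx hy
  exact h _ _ (fun h => hw (by simpa using h)) x hx y hy

/-! ### Crossings between the two sides adjacent to a base -/

/-- The three sides at the vertices `0` and `1` in a frame whose first axis is the side joining
these vertices: its length is `L`, the interior angles are `π / 2 + dA` and `π / 2 + dB`, and the
other two sides have lengths `k` and `l`. -/
structure Corner (F : Frame) (P : Fin 4 → Plane) (L k l dA dB : ℝ) : Prop where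
  ccw : CCW F P
  base : F (P 1 - P 0) = ⟨L, 0⟩
  left : F (P 3 - P 0) = ⟨-(k * Real.sin dA), k * Real.cos dA⟩
  right : F (P 2 - P 1) = ⟨l * Real.sin dB, l * Real.cos dB⟩
  pos : 0 < L
  left_ge : 0.9 * L ≤ k
  right_ge : 0.9 * L ≤ l
  abs_left : |dA| ≤ 0.0588
  abs_right : |dB| ≤ 0.0588

section Corner

variable {R : Set Plane} {F : Frame} {P : Fin 4 → Plane} {L k l dA dB θ θ' y y' η : ℝ}
  {σ : Ball} {n : ℕ}

theorem Corner.mirror (C : Corner F P L k l dA dB) :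
    Corner F.mirror (fun j => P (1 - j)) L l k dB dA := by
  have e2 : (1 - 2 : Fin 4) = 3 := rfl
  have e3 : (1 - 3 : Fin 4) = 2 := rfl
  refine ⟨C.ccw.reflect 1, ?_, ?_, ?_, C.pos, C.right_ge, C.left_ge, C.abs_right, C.abs_left⟩
  · have := C.base
    simp only [Frame.mirror_apply, map_sub, Complex.ext_iff, Complex.sub_re, Complex.sub_im,
      sub_self, sub_zero] at this ⊢
    constructor <;> linarith
  · simp only [e3, sub_zero, Frame.mirror_apply, C.right]
  · simp only [e2, sub_self, Frame.mirror_apply, C.left, neg_neg]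

/-- The bound 0.46 covers 0.4 + 0.0588, a direction angle plus an angle defect. -/
theorem le_cos_of_abs_le {x : ℝ} (hx : |x| ≤ 0.46) : 0.89 < Real.cos x := by
  have h := Real.one_sub_sq_div_two_le_cos (x := x)
  have : x ^ 2 ≤ 0.46 ^ 2 := by
    rw [← sq_abs]; gcongr
  linarith

theorem Corner.frame_right (C : Corner F P L k l dA dB) :
    F (P (1 + 1) - P 1) =
      ⟨l * Real.cos (Real.pi / 2 - dB), l * Real.sin (Real.pi / 2 - dB)⟩ := by
  rw [Real.cos_pi_div_two_sub, Real.sin_pi_div_two_sub]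
  exact C.right

theorem Corner.right_pos (C : Corner F P L k l dA dB) : 0 < l := by
  have := C.pos; have := C.right_ge; linarith

theorem Corner.left_pos (C : Corner F P L k l dA dB) : 0 < k := C.mirror.right_pos

/-- This ensures that the ball passes below the far end of the right side: measured across the
direction of motion, that end is `l * cos (θ + dB)` above vertex `1`. The limit 0.8 is just below
0.9 · 0.89. -/
theorem Corner.right_far (C : Corner F P L k l dA dB) (hθ : |θ| ≤ 0.4) (hy : y ≤ 0.8) :
    L * y < l * Real.cos (θ + dB) := by
  have h1 : 0.89 < Real.cos (θ + dB) :=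
    le_cos_of_abs_le ((abs_add_le _ _).trans (by linarith [C.abs_right]))
  have h2 := C.right_ge
  have h3 := C.pos
  calc L * y ≤ L * 0.8 := by gcongr
    _ < 0.9 * L * 0.89 := by linarith
    _ ≤ l * 0.89 := by gcongr
    _ ≤ l * Real.cos (θ + dB) := by have := C.right_pos; gcongr

/-- From a side adjacent to the base, the ball hits the opposite side directly. -/
theorem Corner.go_direct (C : Corner F P L k l dA dB) (hR : Chords R P) (hθ : |θ| ≤ 0.4)
    (hy : y' = y + Real.sin θ) (h0 : 0 < y') (h1 : y' ≤ 0.8) (ht : θ' = θ + 2 * dB) :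
    Go R P 1 (At F P 3 θ 0 (L * y)) (At F.mirror (fun j => P (1 - j)) 3 θ' 0 (L * y')) := by
  intro σ hσ
  have hb := C.base
  have hr := C.right
  simp only [map_sub, Complex.ext_iff, Complex.sub_re, Complex.sub_im] at hb hr
  have hfar := C.right_far hθ h1
  have hL := mul_pos C.pos h0
  rw [Real.cos_add] at hfar
  have e1 : L * y + hgt θ (F (P 0 - P 1)) = L * y' := by
    simp only [hgt, map_sub, Complex.sub_re, Complex.sub_im]
    rw [hy]
    linear_combination Real.sin θ * hb.1 - Real.cos θ * hb.2
  have e2 : L * y + hgt θ (F (P 0 - P (1 + 1))) =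
      L * y' - l * (Real.cos θ * Real.cos dB - Real.sin θ * Real.sin dB) := by
    simp only [hgt, map_sub, Complex.sub_re, Complex.sub_im]
    rw [hy]
    have : (1 + 1 : Fin 4) = 2 := rfl
    rw [this]
    linear_combination Real.sin θ * hb.1 - Real.cos θ * hb.2 + Real.sin θ * hr.1 -
      Real.cos θ * hr.2
  obtain ⟨σ', h₁, h₂⟩ := hσ.strike C.ccw hR (w' := 1) (by decide) C.right_pos C.frame_right
    (by rw [e1]; exact hL) (by rw [e2]; linarith)
  refine ⟨σ', h₁.reach, ?_⟩
  -- In the mirror image the right side gets the label `3` and its foot becomes vertex `0`, so the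
  -- new state has the same form as the initial one.
  have := (h₂ 1 (Or.inl rfl)).reflect 1
  have e3 : (1 - (1 + 1) : Fin 4) = 3 := rfl
  have e4 : Real.pi - (2 * (Real.pi / 2 - dB) - θ) = θ' := by rw [ht]; ring
  rw [e1, neg_neg, e3, e4] at this
  exact this

/-- From a side adjacent to the base, the ball hits the opposite side after a bounce off the
base. -/
theorem Corner.go_base (C : Corner F P L k l dA dB) (hR : Chords R P) (hθ : |θ| ≤ 0.4)
    (hy0 : 0 < y) (hy : y' = -(y + Real.sin θ)) (h0 : 0 < y') (h1 : y' ≤ 0.8)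
    (ht : θ' = -θ + 2 * dB) :
    Go R P 2 (At F P 3 θ 0 (L * y)) (At F.mirror (fun j => P (1 - j)) 3 θ' 0 (L * y')) := by
  intro σ hσ
  have hb := C.base
  have hr := C.right
  simp only [map_sub, Complex.ext_iff, Complex.sub_re, Complex.sub_im] at hb hr
  have hfar := C.right_far (θ := -θ) (by rwa [abs_neg]) h1
  have hL := mul_pos C.pos h0
  rw [Real.cos_add, Real.cos_neg, Real.sin_neg] at hfar
  have e1 : L * y + hgt θ (F (P 0 - P 1)) = -(L * y') := by
    simp only [hgt, map_sub, Complex.sub_re, Complex.sub_im]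
    rw [hy]
    linear_combination Real.sin θ * hb.1 - Real.cos θ * hb.2
  have e2 : L * y' + hgt (2 * 0 - θ) (F (P 1 - P (1 + 1))) =
      L * y' - l * (Real.cos θ * Real.cos dB - -Real.sin θ * Real.sin dB) := by
    simp only [hgt, map_sub, Complex.sub_re, Complex.sub_im, mul_zero, zero_sub, Real.cos_neg,
      Real.sin_neg]
    have : (1 + 1 : Fin 4) = 2 := rfl
    rw [this]
    linear_combination -Real.sin θ * hr.1 - Real.cos θ * hr.2
  -- The line passes above vertex `0` and below vertex `1`, hence meets the base in between.
  obtain ⟨ρ, h₁, h₂⟩ := hσ.strike C.ccw hR (w' := 0) (r := L) (ω := 0) (by decide) C.pos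
    (by rw [Real.cos_zero, Real.sin_zero, mul_one, mul_zero]; exact C.base)
    (by rw [sub_self, map_zero]; simpa [hgt] using mul_pos C.pos hy0)
    (by rw [zero_add, e1]; linarith)
  have h₃ := h₂ 1 (Or.inr rfl)
  rw [e1, neg_neg] at h₃
  obtain ⟨σ', h₄, h₅⟩ := h₃.strike C.ccw hR (w' := 1) (by decide) C.right_pos C.frame_right
    (by rw [sub_self, map_zero]; simpa [hgt] using hL) (by rw [e2]; linarith)
  refine ⟨σ', h₁.reach.trans h₄.reach, ?_⟩
  have := (h₅ 1 (Or.inl rfl)).reflect 1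
  have e3 : (1 - (1 + 1) : Fin 4) = 3 := rfl
  have e4 : Real.pi - (2 * (Real.pi / 2 - dB) - (2 * 0 - θ)) = θ' := by rw [ht]; ring
  have e5 : - -(L * y' + hgt (2 * 0 - θ) (F (P 1 - P 1))) = L * y' := by simp [hgt]
  rw [e3, e4, e5] at this
  exact this

theorem reflect_reflect (P : Fin 4 → Plane) (i : Fin 4) :
    (fun j => (fun j => P (i - j)) (i - j)) = P := by
  funext j
  simp

theorem Corner.go_direct' (C : Corner F P L k l dA dB) (hR : Chords R P) (hθ : |θ| ≤ 0.4)
    (hy : y' = y + Real.sin θ) (h0 : 0 < y') (h1 : y' ≤ 0.8) (ht : θ' = θ + 2 * dA) :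
    Go R P 1 (At F.mirror (fun j => P (1 - j)) 3 θ 0 (L * y)) (At F P 3 θ' 0 (L * y')) := by
  have := C.mirror.go_direct (hR.of_sidesOf_reflect 1) hθ hy h0 h1 ht
  rw [Frame.mirror_mirror, reflect_reflect] at this
  exact this.of_sidesOf (sidesOf_reflect P 1)

theorem Corner.go_base' (C : Corner F P L k l dA dB) (hR : Chords R P) (hθ : |θ| ≤ 0.4)
    (hy0 : 0 < y) (hy : y' = -(y + Real.sin θ)) (h0 : 0 < y') (h1 : y' ≤ 0.8)
    (ht : θ' = -θ + 2 * dA) :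
    Go R P 2 (At F.mirror (fun j => P (1 - j)) 3 θ 0 (L * y)) (At F P 3 θ' 0 (L * y')) := by
  have := C.mirror.go_base (hR.of_sidesOf_reflect 1) hθ hy0 hy h0 h1 ht
  rw [Frame.mirror_mirror, reflect_reflect] at this
  exact this.of_sidesOf (sidesOf_reflect P 1)

theorem Corner.exists_at (C : Corner F P L k l dA dB) (hθ : |θ| ≤ 0.4) (h0 : 0 < y)
    (h1 : y ≤ 0.8) : ∃ σ, At F P 3 θ 0 (L * y) σ := by
  have hfar := C.mirror.right_far (θ := -θ) (by rwa [abs_neg]) h1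
  rw [Real.cos_add, Real.cos_neg, Real.sin_neg] at hfar
  refine exists_ball_at (w := 3) (mul_pos C.pos h0) ?_
  have e : (3 + 1 : Fin 4) = 0 := rfl
  rw [e, C.left, hgt]
  linarith

theorem At.onSide {w v : Fin 4} (h : At F P w θ v η σ) : OnSide P σ := ⟨w, h.mem, h.wall_eq⟩

/-- The angle `dA` is the direction of the inner normal of the left side. A perpendicular departure
is its own reversal. -/
theorem Corner.rev_eq (C : Corner F P L k l dA dB) (h : At F P 3 dA 0 η σ) : σ.rev = σ := by
  have hs : F (P (3 + 1) - P 3) =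
      ⟨k * Real.cos (dA - Real.pi / 2), k * Real.sin (dA - Real.pi / 2)⟩ := by
    have hl := C.left
    have e : (3 + 1 : Fin 4) = 0 := rfl
    rw [Real.cos_sub_pi_div_two, Real.sin_sub_pi_div_two, e]
    simp only [map_sub, Complex.ext_iff, Complex.sub_re, Complex.sub_im] at hl ⊢
    constructor <;> linarith
  have h1 := frame_reflection C.left_pos.ne' hs h.dir
  have h2 : (wall P 3).reflection σ.dir = -σ.dir := by
    apply F.injective
    rw [wall, h1, map_neg, h.dir]
    have : 2 * (dA - Real.pi / 2) - dA = dA - Real.pi := by ring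
    rw [this, Real.cos_sub_pi, Real.sin_sub_pi]
    rfl
  have h3 := h.wall_eq
  obtain ⟨p, K, u⟩ := σ
  simp only at h3
  subst h3
  simp only [Ball.rev, h2, neg_neg]

/-- A run of the ball that returns to its initial state. -/
theorem Corner.hasLoop (C : Corner F P L k l dA dB)
    (h : Go R P n (At F P 3 θ 0 (L * y)) (At F P 3 θ 0 (L * y))) (hn : 0 < n)
    (hθ : |θ| ≤ 0.4) (h0 : 0 < y) (h1 : y ≤ 0.8) : HasLoop R P n := by
  obtain ⟨σ, hσ⟩ := C.exists_at hθ h0 h1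
  obtain ⟨σ', h₁, h₂⟩ := h σ hσ
  rw [hσ.unique h₂] at h₁
  exact ⟨_, n, hn, le_rfl, hσ.unique h₂ ▸ h₁⟩

/-- A run from a side back to this side which is perpendicular to it at both ends. -/
theorem Corner.hasLoop_perp (C : Corner F P L k l dA dB)
    (h : Go R P n (At F P 3 dA 0 (L * y)) (At F P 3 dA 0 (L * y'))) (hn : 0 < n)
    (h0 : 0 < y) (h1 : y ≤ 0.8) : HasLoop R P (n + n) := by
  obtain ⟨σ, hσ⟩ := C.exists_at (C.abs_left.trans (by norm_num)) h0 h1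
  obtain ⟨σ', h₁, h₂⟩ := h σ hσ
  exact h₁.hasLoop_of_rev hn hσ.onSide (C.rev_eq hσ) (C.rev_eq h₂)

/-- A run from a side to the opposite one which is perpendicular to them at its ends. -/
theorem Corner.hasLoop_perp' (C : Corner F P L k l dA dB)
    (h : Go R P n (At F P 3 dA 0 (L * y)) (At F.mirror (fun j => P (1 - j)) 3 dB 0 (L * y')))
    (hn : 0 < n) (h0 : 0 < y) (h1 : y ≤ 0.8) : HasLoop R P (n + n) := by
  obtain ⟨σ, hσ⟩ := C.exists_at (C.abs_left.trans (by norm_num)) h0 h1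
  obtain ⟨σ', h₁, h₂⟩ := h σ hσ
  exact h₁.hasLoop_of_rev hn hσ.onSide (C.rev_eq hσ) (C.mirror.rev_eq h₂)

end Corner

/-! ### Closed trajectories at a base with an acute angle -/

section Runs

variable {R : Set Plane} {F : Frame} {P : Fin 4 → Plane} {L k l dA dB a b : ℝ}

theorem sin_pos_of_small {x : ℝ} (h : 0 < x) (h' : x ≤ 1) : 0 < Real.sin x :=
  Real.sin_pos_of_pos_of_le_one h h'

theorem sin_lt_sin_of_small {x y : ℝ} (h₁ : -1 ≤ x) (h₂ : x < y) (h₃ : y ≤ 1) :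
    Real.sin x < Real.sin y := by
  have := Real.pi_gt_three
  exact Real.sin_lt_sin_of_lt_of_le_pi_div_two (by linarith) (by linarith) h₂

theorem Corner.small_left (C : Corner F P L k l (-a) dB) : a ≤ 0.0588 := by
  have := (abs_le.1 C.abs_left).1
  linarith

/-- Two right angles: a trajectory parallel to the base. -/
theorem Corner.hasLoop_right_right (C : Corner F P L k l 0 0) (hR : Chords R P) :
    HasLoop R P 2 := by
  have t1 := C.go_direct (y := 0.5) (y' := 0.5) (θ := 0) (θ' := 0) hR (by norm_num) (by simp)
    (by norm_num) (by norm_num) (by ring)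
  have t2 := C.go_direct' (y := 0.5) (y' := 0.5) (θ := 0) (θ' := 0) hR (by norm_num) (by simp)
    (by norm_num) (by norm_num) (by ring)
  exact C.hasLoop (t1.trans t2) (by norm_num) (by norm_num) (by norm_num) (by norm_num)

/-- Two adjacent acute angles: the Fagnano trajectory. -/
theorem Corner.hasLoop_acute_acute (C : Corner F P L k l (-a) (-b)) (hR : Chords R P)
    (ha : 0 < a) (hb : 0 < b) : HasLoop R P 3 := by
  have ha' := C.small_left
  have hb' : b ≤ 0.0588 := C.mirror.small_left
  have sa := sin_pos_of_small ha (by linarith)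
  have sb := sin_pos_of_small hb (by linarith)
  have ca : 0.89 < Real.cos a := le_cos_of_abs_le (abs_le.2 ⟨by linarith, by linarith⟩)
  have cb : 0.89 < Real.cos b := le_cos_of_abs_le (abs_le.2 ⟨by linarith, by linarith⟩)
  have ua : Real.sin a * Real.cos b ≤ 0.8 := by
    nlinarith [Real.sin_lt ha, Real.cos_le_one b]
  have ub : Real.sin b * Real.cos a ≤ 0.8 := by
    nlinarith [Real.sin_lt hb, Real.cos_le_one a]
  have hθ : |b - a| ≤ 0.4 := abs_le.2 ⟨by linarith, by linarith⟩
  -- The heights solve y' - y = sin (b - a) and y + y' = sin (a + b), which is exactly the condition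
  -- for closing up after three bounces.
  have t1 := C.go_direct (y := Real.sin a * Real.cos b) (y' := Real.sin b * Real.cos a)
    (θ := b - a) (θ' := -(a + b)) hR hθ (by rw [Real.sin_sub]; ring) (by positivity) ub (by ring)
  have t2 := C.go_base' (y := Real.sin b * Real.cos a) (y' := Real.sin a * Real.cos b)
    (θ := -(a + b)) (θ' := b - a) hR (by rw [abs_neg]; exact abs_le.2 ⟨by linarith, by linarith⟩)
    (by positivity) (by rw [Real.sin_neg, Real.sin_add]; ring) (by positivity) ua (by ring)
  exact C.hasLoop (t1.trans t2) (by norm_num) hθ (by positivity) ua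

/-- An acute angle next to a right angle. -/
theorem Corner.hasLoop_acute_right (C : Corner F P L k l (-a) 0) (hR : Chords R P)
    (ha : 0 < a) : HasLoop R P 6 := by
  have ha' := C.small_left
  have sa := sin_pos_of_small ha (by linarith)
  have sa' := Real.sin_lt ha
  have hθ : |-a| ≤ 0.4 := abs_le.2 ⟨by linarith, by linarith⟩
  have hθ' : |a| ≤ 0.4 := abs_le.2 ⟨by linarith, by linarith⟩
  -- Any starting height strictly between sin a and 2 sin a would do; this is the midpoint.
  have t1 := C.go_direct (y := 1.5 * Real.sin a) (y' := 0.5 * Real.sin a)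
    (θ := -a) (θ' := -a) hR hθ (by rw [Real.sin_neg]; ring) (by linarith) (by linarith) (by ring)
  have t2 := C.go_base' (y := 0.5 * Real.sin a) (y' := 0.5 * Real.sin a)
    (θ := -a) (θ' := -a) hR hθ (by linarith) (by rw [Real.sin_neg]; ring) (by linarith)
    (by linarith) (by ring)
  have t3 := C.go_base (y := 0.5 * Real.sin a) (y' := 0.5 * Real.sin a)
    (θ := -a) (θ' := a) hR hθ (by linarith) (by rw [Real.sin_neg]; ring) (by linarith)
    (by linarith) (by ring)
  have t4 := C.go_direct' (y := 0.5 * Real.sin a) (y' := 1.5 * Real.sin a)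
    (θ := a) (θ' := -a) hR hθ' (by ring) (by linarith) (by linarith) (by ring)
  exact C.hasLoop (((t1.trans t2).trans t3).trans t4) (by norm_num) hθ (by linarith) (by linarith)

/-- For a = 3b the directions -3b, 5b, -b, b lead from the normal of the left side to the normal of
the right side after four bounces. The ball then returns the same way. -/
theorem Corner.hasLoop_one_third (C : Corner F P L k l (-(3 * b)) b) (hR : Chords R P)
    (hb : 0 < b) : HasLoop R P 8 := by
  have hb' := C.small_left
  have s1 := sin_pos_of_small hb (by linarith)
  have s3 := sin_pos_of_small (x := 3 * b) (by linarith) (by linarith)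
  have s5 := sin_pos_of_small (x := 5 * b) (by linarith) (by linarith)
  have s3' := Real.sin_lt (x := 3 * b) (by linarith)
  have s5' := Real.sin_lt (x := 5 * b) (by linarith)
  have s15 := sin_lt_sin_of_small (x := b) (y := 5 * b) (by linarith) (by linarith) (by linarith)
  have t1 := C.go_base (y := 0.5 * Real.sin (3 * b)) (y' := 0.5 * Real.sin (3 * b))
    (θ := -(3 * b)) (θ' := 5 * b) hR (abs_le.2 ⟨by linarith, by linarith⟩) (by linarith)
    (by rw [Real.sin_neg]; ring) (by linarith) (by linarith) (by ring)
  have t2 := C.go_direct' (y := 0.5 * Real.sin (3 * b))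
    (y' := 0.5 * Real.sin (3 * b) + Real.sin (5 * b))
    (θ := 5 * b) (θ' := -b) hR (abs_le.2 ⟨by linarith, by linarith⟩) rfl (by linarith)
    (by linarith) (by ring)
  have t3 := C.go_direct (y := 0.5 * Real.sin (3 * b) + Real.sin (5 * b))
    (y' := 0.5 * Real.sin (3 * b) + Real.sin (5 * b) - Real.sin b)
    (θ := -b) (θ' := b) hR (abs_le.2 ⟨by linarith, by linarith⟩)
    (by rw [Real.sin_neg]; ring) (by linarith) (by linarith) (by ring)
  exact C.hasLoop_perp' ((t1.trans t2).trans t3) (by norm_num) (by linarith) (by linarith)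

/-- For a = 2b the directions -2b, 4b, 0, 2b, -2b start and end at the normal of the left side,
which gives five bounces out and five back. -/
theorem Corner.hasLoop_one_half (C : Corner F P L k l (-(2 * b)) b) (hR : Chords R P)
    (hb : 0 < b) : HasLoop R P 10 := by
  have hb' := C.small_left
  have s2 := sin_pos_of_small (x := 2 * b) (by linarith) (by linarith)
  have s4 := sin_pos_of_small (x := 4 * b) (by linarith) (by linarith)
  have s2' := Real.sin_lt (x := 2 * b) (by linarith)
  have s4' := Real.sin_lt (x := 4 * b) (by linarith)
  have t1 := C.go_base (y := 0.5 * Real.sin (2 * b)) (y' := 0.5 * Real.sin (2 * b))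
    (θ := -(2 * b)) (θ' := 4 * b) hR (abs_le.2 ⟨by linarith, by linarith⟩) (by linarith)
    (by rw [Real.sin_neg]; ring) (by linarith) (by linarith) (by ring)
  have t2 := C.go_direct' (y := 0.5 * Real.sin (2 * b))
    (y' := 0.5 * Real.sin (2 * b) + Real.sin (4 * b))
    (θ := 4 * b) (θ' := 0) hR (abs_le.2 ⟨by linarith, by linarith⟩) rfl (by linarith)
    (by linarith) (by ring)
  have t3 := C.go_direct (y := 0.5 * Real.sin (2 * b) + Real.sin (4 * b))
    (y' := 0.5 * Real.sin (2 * b) + Real.sin (4 * b))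
    (θ := 0) (θ' := 2 * b) hR (by norm_num) (by rw [Real.sin_zero, add_zero]) (by linarith)
    (by linarith) (by ring)
  have t4 := C.go_direct' (y := 0.5 * Real.sin (2 * b) + Real.sin (4 * b))
    (y' := 0.5 * Real.sin (2 * b) + Real.sin (4 * b) + Real.sin (2 * b))
    (θ := 2 * b) (θ' := -(2 * b)) hR (abs_le.2 ⟨by linarith, by linarith⟩) rfl (by linarith)
    (by linarith) (by ring)
  exact C.hasLoop_perp (((t1.trans t2).trans t3).trans t4) (by norm_num) (by linarith)
    (by linarith)

/-- Ten bounces, two of them off the base, lead from the normal of the left side back to it. The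
comparisons of sines reduce by sum-to-product formulas to the sign of sin (a - 3b). -/
theorem Corner.hasLoop_lt_one_third (C : Corner F P L k l (-a) b) (hR : Chords R P)
    (hb : 0 < b) (hab : 3 * b < a) : HasLoop R P 20 := by
  have ha' := C.small_left
  have p1 := sin_pos_of_small (x := a) (by linarith) (by linarith)
  have p2 := sin_pos_of_small (x := a + 2 * b) (by linarith) (by linarith)
  have p3 := sin_pos_of_small (x := a - 2 * b) (by linarith) (by linarith)
  have p5 := sin_pos_of_small (x := 3 * a - 4 * b) (by linarith) (by linarith)
  have p6 := sin_pos_of_small (x := 3 * a - 2 * b) (by linarith) (by linarith)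
  have u1 := Real.sin_lt (x := a) (by linarith)
  have u2 := Real.sin_lt (x := a + 2 * b) (by linarith)
  have u3 := Real.sin_lt (x := a - 2 * b) (by linarith)
  have u5 := Real.sin_lt (x := 3 * a - 4 * b) (by linarith)
  have u6 := Real.sin_lt (x := 3 * a - 2 * b) (by linarith)
  have m32 := sin_lt_sin_of_small (x := a - 2 * b) (y := a + 2 * b) (by linarith) (by linarith)
    (by linarith)
  have m41 := sin_lt_sin_of_small (x := a - 4 * b) (y := a) (by linarith) (by linarith)
    (by linarith)
  have q := sin_pos_of_small (x := a - 3 * b) (by linarith) (by linarith)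
  have d1 : 0 < Real.sin (3 * a - 4 * b) - Real.sin (a + 2 * b) := by
    have c : 0.89 < Real.cos (2 * a - b) :=
      le_cos_of_abs_le (abs_le.2 ⟨by linarith, by linarith⟩)
    rw [Real.sin_sub_sin, show (3 * a - 4 * b - (a + 2 * b)) / 2 = a - 3 * b by ring,
      show (3 * a - 4 * b + (a + 2 * b)) / 2 = 2 * a - b by ring]
    positivity
  have d2 : 0 < Real.sin (a - 2 * b) + Real.sin (a - 4 * b) := by
    have c : 0.89 < Real.cos b := le_cos_of_abs_le (abs_le.2 ⟨by linarith, by linarith⟩)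
    rw [← sub_neg_eq_add, ← Real.sin_neg, Real.sin_sub_sin,
      show (a - 2 * b - -(a - 4 * b)) / 2 = a - 3 * b by ring,
      show (a - 2 * b + -(a - 4 * b)) / 2 = b by ring]
    positivity
  have n3 : Real.sin (2 * b - a) = -Real.sin (a - 2 * b) := by rw [← Real.sin_neg]; ring_nf
  have n4 : Real.sin (4 * b - a) = -Real.sin (a - 4 * b) := by rw [← Real.sin_neg]; ring_nf
  have n5 : Real.sin (4 * b - 3 * a) = -Real.sin (3 * a - 4 * b) := by
    rw [← Real.sin_neg]; ring_nf
  set S1 := Real.sin a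
  set S2 := Real.sin (a + 2 * b)
  set S3 := Real.sin (a - 2 * b)
  set S4 := Real.sin (a - 4 * b)
  set S5 := Real.sin (3 * a - 4 * b)
  set S6 := Real.sin (3 * a - 2 * b)
  -- The starting height is -c. The four bounds say that the heights before and after each of the
  -- two base bounces are positive. The interval is nonempty because S3 < S2, S4 < S1, S2 < S5 and
  -- S3 + S4 > 0.
  obtain ⟨c, hc1, hc2⟩ : ∃ c, max (-S1) (-S1 - S2 + S3 + S4) < c ∧
      c < min 0 (-S1 - S2 + S3 + S4 + S5) :=
    exists_between (max_lt (lt_min (by linarith) (by linarith))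
      (lt_min (by linarith) (by linarith)))
  obtain ⟨hc1, hc3⟩ := max_lt_iff.1 hc1
  obtain ⟨hc2, hc4⟩ := lt_min_iff.1 hc2
  have t1 := C.go_base (y := -c) (y' := c + S1) (θ := -a) (θ' := a + 2 * b) hR
    (abs_le.2 ⟨by linarith, by linarith⟩) (by linarith) (by rw [Real.sin_neg]; ring)
    (by linarith) (by linarith) (by ring)
  have t2 := C.go_direct' (y := c + S1) (y' := c + S1 + S2) (θ := a + 2 * b) (θ' := 2 * b - a) hR
    (abs_le.2 ⟨by linarith, by linarith⟩) rfl (by linarith) (by linarith) (by ring)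
  have t3 := C.go_direct (y := c + S1 + S2) (y' := c + S1 + S2 - S3) (θ := 2 * b - a)
    (θ' := 4 * b - a) hR (abs_le.2 ⟨by linarith, by linarith⟩) (by rw [n3]; ring) (by linarith)
    (by linarith) (by ring)
  have t4 := C.go_direct' (y := c + S1 + S2 - S3) (y' := c + S1 + S2 - S3 - S4) (θ := 4 * b - a)
    (θ' := 4 * b - 3 * a) hR (abs_le.2 ⟨by linarith, by linarith⟩) (by rw [n4]; ring)
    (by linarith) (by linarith) (by ring)
  have t5 := C.go_base (y := c + S1 + S2 - S3 - S4) (y' := -S1 - S2 + S3 + S4 + S5 - c)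
    (θ := 4 * b - 3 * a) (θ' := 3 * a - 2 * b) hR (abs_le.2 ⟨by linarith, by linarith⟩)
    (by linarith) (by rw [n5]; ring) (by linarith) (by linarith) (by ring)
  have t6 := C.go_direct' (y := -S1 - S2 + S3 + S4 + S5 - c)
    (y' := -S1 - S2 + S3 + S4 + S5 - c + S6)
    (θ := 3 * a - 2 * b) (θ' := a - 2 * b) hR (abs_le.2 ⟨by linarith, by linarith⟩)
    rfl (by linarith) (by linarith) (by ring)
  have t7 := C.go_direct (y := -S1 - S2 + S3 + S4 + S5 - c + S6)
    (y' := -S1 - S2 + S3 + S4 + S5 - c + S6 + S3)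
    (θ := a - 2 * b) (θ' := a) hR (abs_le.2 ⟨by linarith, by linarith⟩)
    rfl (by linarith) (by linarith) (by ring)
  have t8 := C.go_direct' (y := -S1 - S2 + S3 + S4 + S5 - c + S6 + S3)
    (y' := -S1 - S2 + S3 + S4 + S5 - c + S6 + S3 + S1)
    (θ := a) (θ' := -a) hR (abs_le.2 ⟨by linarith, by linarith⟩)
    rfl (by linarith) (by linarith) (by ring)
  exact C.hasLoop_perp (((((((t1.trans t2).trans t3).trans t4).trans t5).trans t6).trans t7).trans
    t8) (by norm_num) (by linarith) (by linarith)

/-- For a < 3b two further crossings are needed before the second base bounce, so one way takes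
fourteen bounces. One end of the range keeps the lower bound on -(starting height) below 0; the
other keeps the upper bound above -sin a. -/
theorem Corner.hasLoop_lt_one_half (C : Corner F P L k l (-a) b) (hR : Chords R P)
    (hab : a < 3 * b) (hab' : 2 * b < a) : HasLoop R P 28 := by
  have ha' := C.small_left
  have p1 := sin_pos_of_small (x := a) (by linarith) (by linarith)
  have p2 := sin_pos_of_small (x := a + 2 * b) (by linarith) (by linarith)
  have p3 := sin_pos_of_small (x := a - 2 * b) (by linarith) (by linarith)
  have p4 := sin_pos_of_small (x := 4 * b - a) (by linarith) (by linarith)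
  have p5 := sin_pos_of_small (x := 3 * a - 4 * b) (by linarith) (by linarith)
  have p6 := sin_pos_of_small (x := 3 * a - 6 * b) (by linarith) (by linarith)
  have p7 := sin_pos_of_small (x := 5 * a - 6 * b) (by linarith) (by linarith)
  have p8 := sin_pos_of_small (x := 5 * a - 4 * b) (by linarith) (by linarith)
  have p9 := sin_pos_of_small (x := 3 * a - 2 * b) (by linarith) (by linarith)
  have u1 := Real.sin_lt (x := a) (by linarith)
  have u2 := Real.sin_lt (x := a + 2 * b) (by linarith)
  have u3 := Real.sin_lt (x := a - 2 * b) (by linarith)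
  have u4 := Real.sin_lt (x := 4 * b - a) (by linarith)
  have u5 := Real.sin_lt (x := 3 * a - 4 * b) (by linarith)
  have u6 := Real.sin_lt (x := 3 * a - 6 * b) (by linarith)
  have u7 := Real.sin_lt (x := 5 * a - 6 * b) (by linarith)
  have u8 := Real.sin_lt (x := 5 * a - 4 * b) (by linarith)
  have u9 := Real.sin_lt (x := 3 * a - 2 * b) (by linarith)
  have m32 := sin_lt_sin_of_small (x := a - 2 * b) (y := a + 2 * b) (by linarith) (by linarith)
    (by linarith)
  have q := sin_pos_of_small (x := 3 * b - a) (by linarith) (by linarith)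
  have q' := sin_pos_of_small (x := 2 * a - 4 * b) (by linarith) (by linarith)
  -- the first group of inequalities: the sixth height is negative
  have d1 : 0 < Real.sin a - Real.sin (3 * a - 6 * b) := by
    have c : 0.89 < Real.cos (2 * a - 3 * b) :=
      le_cos_of_abs_le (abs_le.2 ⟨by linarith, by linarith⟩)
    rw [Real.sin_sub_sin, show (a - (3 * a - 6 * b)) / 2 = 3 * b - a by ring,
      show (a + (3 * a - 6 * b)) / 2 = 2 * a - 3 * b by ring]
    positivity
  have d2 : 0 < Real.sin (a + 2 * b) - Real.sin (3 * a - 4 * b) := by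
    have c : 0.89 < Real.cos (2 * a - b) :=
      le_cos_of_abs_le (abs_le.2 ⟨by linarith, by linarith⟩)
    rw [Real.sin_sub_sin, show (a + 2 * b - (3 * a - 4 * b)) / 2 = 3 * b - a by ring,
      show (a + 2 * b + (3 * a - 4 * b)) / 2 = 2 * a - b by ring]
    positivity
  have d3 := sin_lt_sin_of_small (x := a - 2 * b) (y := 4 * b - a) (by linarith) (by linarith)
    (by linarith)
  -- the second group: the seventh height exceeds the first one
  have e1 : 0 < Real.sin (5 * a - 6 * b) - Real.sin (a + 2 * b) := by
    have c : 0.89 < Real.cos (3 * a - 2 * b) :=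
      le_cos_of_abs_le (abs_le.2 ⟨by linarith, by linarith⟩)
    rw [Real.sin_sub_sin, show (5 * a - 6 * b - (a + 2 * b)) / 2 = 2 * a - 4 * b by ring,
      show (5 * a - 6 * b + (a + 2 * b)) / 2 = 3 * a - 2 * b by ring]
    positivity
  have e2 := sin_lt_sin_of_small (x := 4 * b - a) (y := 3 * a - 4 * b) (by linarith)
    (by linarith) (by linarith)
  have n3 : Real.sin (2 * b - a) = -Real.sin (a - 2 * b) := by rw [← Real.sin_neg]; ring_nf
  have n5 : Real.sin (4 * b - 3 * a) = -Real.sin (3 * a - 4 * b) := by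
    rw [← Real.sin_neg]; ring_nf
  have n6 : Real.sin (6 * b - 3 * a) = -Real.sin (3 * a - 6 * b) := by
    rw [← Real.sin_neg]; ring_nf
  have n7 : Real.sin (6 * b - 5 * a) = -Real.sin (5 * a - 6 * b) := by
    rw [← Real.sin_neg]; ring_nf
  set S1 := Real.sin a
  set S2 := Real.sin (a + 2 * b)
  set S3 := Real.sin (a - 2 * b)
  set S4 := Real.sin (4 * b - a)
  set S5 := Real.sin (3 * a - 4 * b)
  set S6 := Real.sin (3 * a - 6 * b)
  set S7 := Real.sin (5 * a - 6 * b)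
  set S8 := Real.sin (5 * a - 4 * b)
  set S9 := Real.sin (3 * a - 2 * b)
  -- Again -c is the starting height and the bounds express positivity around the two base bounces.
  -- The first group of inequalities gives lower bound < 0, the second gives -S1 < upper bound.
  obtain ⟨c, hc1, hc2⟩ : ∃ c, max (-S1) (-S1 - S2 + S3 - S4 + S5 + S6) < c ∧
      c < min 0 (-S1 - S2 + S3 - S4 + S5 + S6 + S7) :=
    exists_between (max_lt (lt_min (by linarith) (by linarith))
      (lt_min (by linarith) (by linarith)))
  obtain ⟨hc1, hc3⟩ := max_lt_iff.1 hc1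
  obtain ⟨hc2, hc4⟩ := lt_min_iff.1 hc2
  have t1 := C.go_base (y := -c) (y' := c + S1) (θ := -a) (θ' := a + 2 * b) hR
    (abs_le.2 ⟨by linarith, by linarith⟩) (by linarith) (by rw [Real.sin_neg]; ring)
    (by linarith) (by linarith) (by ring)
  have t2 := C.go_direct' (y := c + S1) (y' := c + S1 + S2) (θ := a + 2 * b) (θ' := 2 * b - a) hR
    (abs_le.2 ⟨by linarith, by linarith⟩) rfl (by linarith) (by linarith) (by ring)
  have t3 := C.go_direct (y := c + S1 + S2) (y' := c + S1 + S2 - S3) (θ := 2 * b - a)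
    (θ' := 4 * b - a) hR (abs_le.2 ⟨by linarith, by linarith⟩) (by rw [n3]; ring) (by linarith)
    (by linarith) (by ring)
  have t4 := C.go_direct' (y := c + S1 + S2 - S3) (y' := c + S1 + S2 - S3 + S4) (θ := 4 * b - a)
    (θ' := 4 * b - 3 * a) hR (abs_le.2 ⟨by linarith, by linarith⟩) rfl
    (by linarith) (by linarith) (by ring)
  have t5 := C.go_direct (y := c + S1 + S2 - S3 + S4) (y' := c + S1 + S2 - S3 + S4 - S5)
    (θ := 4 * b - 3 * a) (θ' := 6 * b - 3 * a) hR (abs_le.2 ⟨by linarith, by linarith⟩)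
    (by rw [n5]; ring) (by linarith) (by linarith) (by ring)
  have t6 := C.go_direct' (y := c + S1 + S2 - S3 + S4 - S5)
    (y' := c + S1 + S2 - S3 + S4 - S5 - S6)
    (θ := 6 * b - 3 * a) (θ' := 6 * b - 5 * a) hR (abs_le.2 ⟨by linarith, by linarith⟩)
    (by rw [n6]; ring) (by linarith) (by linarith) (by ring)
  have t7 := C.go_base (y := c + S1 + S2 - S3 + S4 - S5 - S6)
    (y' := -S1 - S2 + S3 - S4 + S5 + S6 + S7 - c)
    (θ := 6 * b - 5 * a) (θ' := 5 * a - 4 * b) hR (abs_le.2 ⟨by linarith, by linarith⟩)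
    (by linarith) (by rw [n7]; ring) (by linarith) (by linarith) (by ring)
  have t8 := C.go_direct' (y := -S1 - S2 + S3 - S4 + S5 + S6 + S7 - c)
    (y' := -S1 - S2 + S3 - S4 + S5 + S6 + S7 - c + S8)
    (θ := 5 * a - 4 * b) (θ' := 3 * a - 4 * b) hR (abs_le.2 ⟨by linarith, by linarith⟩)
    rfl (by linarith) (by linarith) (by ring)
  have t9 := C.go_direct (y := -S1 - S2 + S3 - S4 + S5 + S6 + S7 - c + S8)
    (y' := -S1 - S2 + S3 - S4 + S5 + S6 + S7 - c + S8 + S5)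
    (θ := 3 * a - 4 * b) (θ' := 3 * a - 2 * b) hR (abs_le.2 ⟨by linarith, by linarith⟩)
    rfl (by linarith) (by linarith) (by ring)
  have t10 := C.go_direct' (y := -S1 - S2 + S3 - S4 + S5 + S6 + S7 - c + S8 + S5)
    (y' := -S1 - S2 + S3 - S4 + S5 + S6 + S7 - c + S8 + S5 + S9)
    (θ := 3 * a - 2 * b) (θ' := a - 2 * b) hR (abs_le.2 ⟨by linarith, by linarith⟩)
    rfl (by linarith) (by linarith) (by ring)
  have t11 := C.go_direct (y := -S1 - S2 + S3 - S4 + S5 + S6 + S7 - c + S8 + S5 + S9)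
    (y' := -S1 - S2 + S3 - S4 + S5 + S6 + S7 - c + S8 + S5 + S9 + S3)
    (θ := a - 2 * b) (θ' := a) hR (abs_le.2 ⟨by linarith, by linarith⟩)
    rfl (by linarith) (by linarith) (by ring)
  have t12 := C.go_direct' (y := -S1 - S2 + S3 - S4 + S5 + S6 + S7 - c + S8 + S5 + S9 + S3)
    (y' := -S1 - S2 + S3 - S4 + S5 + S6 + S7 - c + S8 + S5 + S9 + S3 + S1)
    (θ := a) (θ' := -a) hR (abs_le.2 ⟨by linarith, by linarith⟩)
    rfl (by linarith) (by linarith) (by ring)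
  exact C.hasLoop_perp (((((((((((t1.trans t2).trans t3).trans t4).trans t5).trans t6).trans
    t7).trans t8).trans t9).trans t10).trans t11).trans t12) (by norm_num) (by linarith)
    (by linarith)

/-- An acute angle next to an obtuse one, if the latter differs from a right angle by at most
half as much as the former. -/
theorem Corner.hasLoop_acute_obtuse (C : Corner F P L k l (-a) b) (hR : Chords R P)
    (hb : 0 < b) (hab : 2 * b ≤ a) : HasLoop R P 28 := by
  rcases hab.eq_or_lt with rfl | hab
  · exact (C.hasLoop_one_half hR hb).mono (by norm_num)
  rcases lt_trichotomy (3 * b) a with h | rfl | h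
  · exact (C.hasLoop_lt_one_third hR hb h).mono (by norm_num)
  · exact (C.hasLoop_one_third hR hb).mono (by norm_num)
  · exact C.hasLoop_lt_one_half hR h hab

end Runs

/-! ### Two opposite acute angles -/

/-- The frame with both axes reversed. -/
noncomputable def Frame.neg (F : Frame) : Frame := F.trans (LinearIsometryEquiv.neg ℝ)

theorem Frame.neg_apply (F : Frame) (v : Plane) : F.neg v = -F v := rfl

theorem cr_neg (F : Frame) (u v : Plane) : cr F.neg u v = cr F u v := by
  simp [cr, Frame.neg_apply]

theorem CCW.neg {F : Frame} {P : Fin 4 → Plane} (h : CCW F P) : CCW F.neg P := by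
  intro w
  rw [cr_neg]
  exact h w

theorem At.neg {F : Frame} {P : Fin 4 → Plane} {w v : Fin 4} {θ η : ℝ} {σ : Ball}
    (h : At F P w θ v η σ) : At F.neg P w (θ - Real.pi) v η σ := by
  refine ⟨h.mem, h.wall_eq, ?_, by rw [cr_neg]; exact h.inward, by rw [cr_neg]; exact h.height⟩
  rw [Frame.neg_apply, h.dir, Real.cos_sub_pi, Real.sin_sub_pi]
  rfl

/-- A convex quadrilateral in a frame whose first axis is the diagonal from vertex `0` to vertex
`2`. The diagonal makes the angles `α₁`, `γ₁`, `γ₂`, `α₂` with the four sides. -/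
structure Diag (F : Frame) (P : Fin 4 → Plane) (M r₁ r₂ r₃ r₄ α₁ α₂ γ₁ γ₂ : ℝ) : Prop where
  ccw : CCW F P
  diag : F (P 2 - P 0) = ⟨M, 0⟩
  side₁ : F (P 1 - P 0) = ⟨r₁ * Real.cos α₁, -(r₁ * Real.sin α₁)⟩
  side₂ : F (P 2 - P 1) = ⟨r₂ * Real.cos γ₁, r₂ * Real.sin γ₁⟩
  side₃ : F (P 3 - P 2) = ⟨-(r₃ * Real.cos γ₂), r₃ * Real.sin γ₂⟩
  side₄ : F (P 0 - P 3) = ⟨-(r₄ * Real.cos α₂), -(r₄ * Real.sin α₂)⟩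
  pos : 0 < M
  le₁ : 0.4 * M ≤ r₁
  le₂ : 0.4 * M ≤ r₂
  le₃ : 0.4 * M ≤ r₃
  le₄ : 0.4 * M ≤ r₄
  mem_α₁ : α₁ ∈ Set.Icc 0.38 1.17
  mem_α₂ : α₂ ∈ Set.Icc 0.38 1.17
  mem_γ₁ : γ₁ ∈ Set.Icc 0.38 1.17
  mem_γ₂ : γ₂ ∈ Set.Icc 0.38 1.17

section Diag

variable {R : Set Plane} {F : Frame} {P : Fin 4 → Plane}
  {M r₁ r₂ r₃ r₄ α₁ α₂ γ₁ γ₂ a c : ℝ}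

theorem Diag.swap (D : Diag F P M r₁ r₂ r₃ r₄ α₁ α₂ γ₁ γ₂) :
    Diag F.mirror.neg (fun j => P (0 - j)) M r₄ r₃ r₂ r₁ α₂ α₁ γ₂ γ₁ := by
  have e1 : (0 - 1 : Fin 4) = 3 := rfl
  have e2 : (0 - 2 : Fin 4) = 2 := rfl
  have e3 : (0 - 3 : Fin 4) = 1 := rfl
  have h0 := D.diag
  have h1 := D.side₁
  have h2 := D.side₂
  have h3 := D.side₃
  have h4 := D.side₄
  simp only [map_sub, Complex.ext_iff, Complex.sub_re, Complex.sub_im] at h0 h1 h2 h3 h4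
  refine ⟨(D.ccw.reflect 0).neg, ?_, ?_, ?_, ?_, ?_, D.pos, D.le₄, D.le₃, D.le₂, D.le₁,
    D.mem_α₂, D.mem_α₁, D.mem_γ₂, D.mem_γ₁⟩
  all_goals
    simp only [e1, e2, e3, sub_zero, Frame.neg_apply, Frame.mirror_apply, Complex.ext_iff,
      Complex.neg_re, Complex.neg_im, neg_neg, map_sub, Complex.sub_re, Complex.sub_im]
    constructor <;> linarith

/-- Jordan's inequality sin x ≥ 2x/π. -/
theorem sin_ge_of_mem {x : ℝ} (h : x ∈ Set.Icc 0.27 1.4) : 0.17 ≤ Real.sin x := by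
  have h3 := Real.pi_gt_three
  have h4 := Real.pi_lt_d2
  have := Real.mul_le_sin (x := x) (by linarith [h.1]) (by linarith [h.2])
  have h5 : 0.63 ≤ 2 / Real.pi := by
    rw [le_div_iff₀ (by linarith)]
    linarith
  nlinarith [h.1]

/-- The ball passes so close to the acute vertices that it cannot overshoot the sides there: 0.0588
< 0.4 · 0.17. -/
theorem Diag.far (D : Diag F P M r₁ r₂ r₃ r₄ α₁ α₂ γ₁ γ₂) (ha : 0 < a) (ha' : a ≤ 0.0588)
    {r x y : ℝ} (hr : 0.4 * M ≤ r) (hx : x ∈ Set.Icc 0.27 1.4) :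
    M * (Real.sin a * Real.cos y) < r * Real.sin x := by
  have h1 := sin_ge_of_mem hx
  have h2 := Real.sin_lt ha
  have h3 := sin_pos_of_small ha (by linarith)
  have h4 : Real.sin a * Real.cos y ≤ Real.sin a := mul_le_of_le_one_right h3.le (Real.cos_le_one y)
  have hM := D.pos
  calc M * (Real.sin a * Real.cos y) ≤ M * 0.0588 := by gcongr; linarith
    _ < 0.4 * M * 0.17 := by linarith
    _ ≤ r * Real.sin x := by gcongr; linarith

/-- The bounces off sides `2` and `1` keep the distance from vertex `2` and turn the direction by
twice its angle, that is by π - 2c. The ball then crosses the diagonal, and sides `3` and `0` do the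
same at vertex `0`. The chosen direction and height make the final state take the initial form after
reflection in the diagonal. -/
theorem Diag.go_half (D : Diag F P M r₁ r₂ r₃ r₄ α₁ α₂ γ₁ γ₂) (hR : Chords R P)
    (ha : 0 < a) (ha' : a ≤ 0.0588) (hc : 0 < c) (hc' : c ≤ 0.0588)
    (hα : α₁ + α₂ = Real.pi / 2 - a) (hγ : γ₁ + γ₂ = Real.pi / 2 - c) :
    Go R P 4 (At F P 3 (c - a) 0 (M * (Real.sin a * Real.cos c)))
      (At F.mirror.neg (fun j => P (0 - j)) 3 (c - a) 0 (M * (Real.sin a * Real.cos c))) := by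
  intro σ hσ
  have hM := D.pos
  have π3 := Real.pi_gt_three
  have π4 := Real.pi_lt_d2
  obtain ⟨bα1, bα2⟩ := D.mem_α₂
  obtain ⟨bγ1, bγ2⟩ := D.mem_γ₂
  have sa := sin_pos_of_small ha (by linarith)
  have sc := sin_pos_of_small hc (by linarith)
  have ca : 0.89 < Real.cos a := le_cos_of_abs_le (abs_le.2 ⟨by linarith, by linarith⟩)
  have cc : 0.89 < Real.cos c := le_cos_of_abs_le (abs_le.2 ⟨by linarith, by linarith⟩)
  have hη₀ : 0 < M * (Real.sin a * Real.cos c) := by positivity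
  have hη₁ : 0 < M * (Real.sin c * Real.cos a) := by positivity
  have hr₁ : 0 < r₁ := by linarith [D.le₁]
  have hr₂ : 0 < r₂ := by linarith [D.le₂]
  have hr₃ : 0 < r₃ := by linarith [D.le₃]
  have hr₄ : 0 < r₄ := by linarith [D.le₄]
  have f1 : (1 + 1 : Fin 4) = 2 := rfl
  have f2 : (2 + 1 : Fin 4) = 3 := rfl
  have f3 : (3 + 1 : Fin 4) = 0 := rfl
  have f0 : (0 + 1 : Fin 4) = 1 := rfl
  -- first bounce
  have n02 : F (P 0 - P 2) = ⟨-M, 0⟩ := by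
    rw [← neg_sub, map_neg, D.diag]; simp [Complex.ext_iff]
  have n01 : F (P 0 - P 1) = ⟨-(r₁ * Real.cos α₁), r₁ * Real.sin α₁⟩ := by
    rw [← neg_sub, map_neg, D.side₁]; simp [Complex.ext_iff]
  have n23 : F (P 2 - P 3) = ⟨r₃ * Real.cos γ₂, -(r₃ * Real.sin γ₂)⟩ := by
    rw [← neg_sub, map_neg, D.side₃]; simp [Complex.ext_iff]
  have k1 : M * (Real.sin a * Real.cos c) + hgt (c - a) (F (P 0 - P 2)) =
      M * (Real.sin c * Real.cos a) := by
    rw [n02, hgt, Real.sin_sub]; ring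
  have k2 : M * (Real.sin a * Real.cos c) + hgt (c - a) (F (P 0 - P (2 + 1))) =
      M * (Real.sin a * Real.cos c) - r₄ * Real.sin (α₂ - (c - a)) := by
    rw [f2, D.side₄, hgt, Real.sin_sub α₂]; ring
  obtain ⟨σ₁, b₁, h₁⟩ := hσ.strike D.ccw hR (w' := 2) (r := r₃) (ω := Real.pi - γ₂) (by decide) hr₃
    (by rw [f2, D.side₃, Real.cos_pi_sub, Real.sin_pi_sub, mul_neg]) (by rw [k1]; exact hη₁)
    (by
      rw [k2]
      linarith [D.far (y := c) ha ha' D.le₄ (x := α₂ - (c - a)) ⟨by linarith, by linarith⟩])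
  have h₁ := h₁ 2 (Or.inl rfl)
  rw [k1] at h₁
  -- second bounce
  have k3 : -(M * (Real.sin c * Real.cos a)) +
      hgt (2 * (Real.pi - γ₂) - (c - a)) (F (P 2 - P 1)) =
      -(M * (Real.sin c * Real.cos a)) + r₂ * Real.sin (Real.pi / 2 + a - γ₂) := by
    have : hgt (2 * (Real.pi - γ₂) - (c - a)) (F (P 2 - P 1)) =
        r₂ * Real.sin (γ₁ - (2 * (Real.pi - γ₂) - (c - a))) := by
      rw [D.side₂, hgt, Real.sin_sub γ₁]; ring
    rw [this, show γ₁ - (2 * (Real.pi - γ₂) - (c - a)) = Real.pi - (Real.pi / 2 + a - γ₂) - 2 * Real.pi by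
      linear_combination hγ, Real.sin_sub_two_pi, Real.sin_pi_sub]
  obtain ⟨σ₂, b₂, h₂⟩ := h₁.strike D.ccw hR (w' := 1) (r := r₂) (ω := γ₁) (by decide) hr₂
    (by rw [f1, D.side₂])
    (by
      rw [k3]
      linarith [D.far (y := a) hc hc' D.le₂ (x := Real.pi / 2 + a - γ₂)
        ⟨by linarith, by linarith⟩])
    (by rw [f1, sub_self, map_zero]; simp only [hgt, Complex.zero_im, Complex.zero_re]; linarith)
  have h₂ := h₂ 2 (Or.inr rfl)
  have k4 : 2 * γ₁ - (2 * (Real.pi - γ₂) - (c - a)) = -(a + c) - Real.pi := by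
    linear_combination 2 * hγ
  have k5 : -(-(M * (Real.sin c * Real.cos a)) +
      hgt (2 * (Real.pi - γ₂) - (c - a)) (F (P 2 - P 2))) = M * (Real.sin c * Real.cos a) := by
    simp [hgt]
  rw [k4, k5] at h₂
  -- third bounce
  have k6 : M * (Real.sin c * Real.cos a) + hgt (-(a + c) - Real.pi) (F (P 2 - P 0)) =
      -(M * (Real.sin a * Real.cos c)) := by
    rw [D.diag, hgt, Real.sin_sub_pi, Real.sin_neg, Real.sin_add]; ring
  have k7 : M * (Real.sin c * Real.cos a) + hgt (-(a + c) - Real.pi) (F (P 2 - P 3)) =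
      M * (Real.sin c * Real.cos a) + r₃ * Real.sin (γ₂ - (a + c)) := by
    rw [n23, hgt, Real.sin_sub_pi, Real.cos_sub_pi, Real.sin_neg, Real.cos_neg,
      Real.sin_sub γ₂]; ring
  obtain ⟨σ₃, b₃, h₃⟩ := h₂.strike D.ccw hR (w' := 3) (r := r₄) (ω := α₂ - Real.pi) (by decide) hr₄
    (by rw [f3, D.side₄, Real.cos_sub_pi, Real.sin_sub_pi, mul_neg, mul_neg])
    (by
      rw [k7]
      have := sin_pos_of_small (x := γ₂ - (a + c)) (by linarith)
      -- Only positivity of the sine is needed here; the angle may fall slightly below 0.27.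
      by_cases h : γ₂ - (a + c) ≤ 1
      · have := this h
        positivity
      · have := sin_ge_of_mem (x := γ₂ - (a + c)) ⟨by linarith, by linarith⟩
        have : 0 < Real.sin (γ₂ - (a + c)) := by linarith
        positivity)
    (by rw [f3, k6]; linarith)
  have h₃ := h₃ 0 (Or.inr rfl)
  rw [k6, neg_neg] at h₃
  -- fourth bounce
  have k8 : M * (Real.sin a * Real.cos c) +
      hgt (2 * (α₂ - Real.pi) - (-(a + c) - Real.pi)) (F (P 0 - P 1)) =
      M * (Real.sin a * Real.cos c) - r₁ * Real.sin (Real.pi / 2 - α₂ - c) := by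
    have : hgt (2 * (α₂ - Real.pi) - (-(a + c) - Real.pi)) (F (P 0 - P 1)) =
        r₁ * Real.sin ((2 * (α₂ - Real.pi) - (-(a + c) - Real.pi)) + α₁) := by
      rw [n01, hgt, Real.sin_add _ α₁]; ring
    rw [this, show 2 * (α₂ - Real.pi) - (-(a + c) - Real.pi) + α₁ = -(Real.pi / 2 - α₂ - c) by
      linear_combination hα, Real.sin_neg]
    ring
  obtain ⟨σ₄, b₄, h₄⟩ := h₃.strike D.ccw hR (w' := 0) (r := r₁) (ω := -α₁) (by decide) hr₁
    (by rw [f0, D.side₁, Real.cos_neg, Real.sin_neg, mul_neg])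
    (by rw [sub_self, map_zero]; simpa [hgt] using hη₀)
    (by
      rw [f0, k8]
      linarith [D.far (y := c) ha ha' D.le₁ (x := Real.pi / 2 - α₂ - c)
        ⟨by linarith, by linarith⟩])
  have h₄ := ((h₄ 0 (Or.inl rfl)).reflect 0).neg
  have g1 : (0 - (0 + 1) : Fin 4) = 3 := rfl
  have g2 : (0 - 0 : Fin 4) = 0 := rfl
  have g3 : Real.pi - (2 * -α₁ - (2 * (α₂ - Real.pi) - (-(a + c) - Real.pi))) - Real.pi = c - a := by
    linear_combination 2 * hα
  rw [g1, g2, g3, sub_self, map_zero] at h₄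
  refine ⟨σ₄, ((b₁.reach.trans b₂.reach).trans b₃.reach).trans b₄.reach, ?_⟩
  simpa [hgt] using h₄

theorem Frame.mirror_neg_mirror_neg (F : Frame) : F.mirror.neg.mirror.neg = F := by
  ext v
  apply Complex.ext <;> simp [Frame.mirror_apply, Frame.neg_apply]

/-- Two opposite acute angles. -/
theorem Diag.hasLoop (D : Diag F P M r₁ r₂ r₃ r₄ α₁ α₂ γ₁ γ₂) (hR : Chords R P)
    (ha : 0 < a) (ha' : a ≤ 0.0588) (hc : 0 < c) (hc' : c ≤ 0.0588)
    (hα : α₁ + α₂ = Real.pi / 2 - a) (hγ : γ₁ + γ₂ = Real.pi / 2 - c) : HasLoop R P 8 := by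
  have t1 := D.go_half hR ha ha' hc hc' hα hγ
  -- The direction and the height depend only on the angle sums at vertices `0` and `2`, so the
  -- second half is the first one for the mirrored quadrilateral, even if that is not congruent to
  -- the original.
  have t2 := D.swap.go_half (hR.of_sidesOf_reflect 0) ha ha' hc hc' (by linarith) (by linarith)
  rw [Frame.mirror_neg_mirror_neg, reflect_reflect] at t2
  have t := t1.trans (t2.of_sidesOf (sidesOf_reflect P 0))
  obtain ⟨bα1, bα2⟩ := D.mem_α₂
  have sa := sin_pos_of_small ha (by linarith)
  have cc : 0.89 < Real.cos c := le_cos_of_abs_le (abs_le.2 ⟨by linarith, by linarith⟩)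
  have hM := D.pos
  have f3 : (3 + 1 : Fin 4) = 0 := rfl
  have k : hgt (c - a) (F (P 3 - P (3 + 1))) = r₄ * Real.sin (α₂ - (c - a)) := by
    rw [f3, ← neg_sub (P 0), map_neg, D.side₄, hgt, Real.sin_sub α₂]
    simp only [Complex.neg_re, Complex.neg_im]
    ring
  obtain ⟨σ, hσ⟩   := exists_ball_at (F := F) (P := P) (w := 3) (θ := c - a)
    (η := M * (Real.sin a * Real.cos c)) (by positivity)
    (by
      rw [k]
      exact D.far (y := c) ha ha' D.le₄ (x := α₂ - (c - a)) ⟨by linarith, by linarith⟩)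
  rw [f3] at hσ
  obtain ⟨σ', h₁, h₂⟩ := t σ hσ
  rw [hσ.unique h₂] at h₁
  exact ⟨_, 8, by norm_num, le_rfl, hσ.unique h₂ ▸ h₁⟩

end Diag

/-! ### The case distinction on the angle defects -/

/-- The frame `F` rotated by the angle `φ`. -/
noncomputable def Frame.rot (F : Frame) (φ : ℝ) : Frame :=
  F.trans (rotation (Circle.exp (-φ)))

theorem Frame.rot_apply (F : Frame) (φ : ℝ) (v : Plane) :
    F.rot φ v = ⟨Real.cos φ * (F v).re + Real.sin φ * (F v).im,
      Real.cos φ * (F v).im - Real.sin φ * (F v).re⟩ := by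
  have h : F.rot φ v = Complex.exp (((-φ : ℝ) : ℂ) * Complex.I) * F v := by
    show rotation (Circle.exp (-φ)) (F v) = _
    rw [rotation_apply, Circle.coe_exp]
  rw [h]
  apply Complex.ext
  · rw [Complex.mul_re, Complex.exp_ofReal_mul_I_re, Complex.exp_ofReal_mul_I_im, Real.cos_neg,
      Real.sin_neg]
    ring
  · rw [Complex.mul_im, Complex.exp_ofReal_mul_I_re, Complex.exp_ofReal_mul_I_im, Real.cos_neg,
      Real.sin_neg]
    ring

theorem cr_rot (F : Frame) (φ : ℝ) (u v : Plane) : cr (F.rot φ) u v = cr F u v := by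
  simp only [cr, Frame.rot_apply]
  linear_combination ((F u).re * (F v).im - (F u).im * (F v).re) * Real.cos_sq_add_sin_sq φ

theorem CCW.rot {F : Frame} {P : Fin 4 → Plane} (h : CCW F P) (φ : ℝ) : CCW (F.rot φ) P := by
  intro w
  rw [cr_rot]
  exact h w

/-- A convex quadrilateral in a frame whose first axis is the side with label `0`. The interior
angles are `π / 2 + d i`, the sides have length `ℓ i`, and the quadrilateral is close to a square
of side length `M / √2`. -/
structure Quad (F : Frame) (P : Fin 4 → Plane) (ℓ d : Fin 4 → ℝ) (M : ℝ) : Prop where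
  ccw : CCW F P
  side₀ : F (P 1 - P 0) = ⟨ℓ 0, 0⟩
  side₁ : F (P 2 - P 1) = ⟨ℓ 1 * Real.sin (d 1), ℓ 1 * Real.cos (d 1)⟩
  side₂ : F (P 3 - P 2) = ⟨-(ℓ 2 * Real.cos (d 1 + d 2)), ℓ 2 * Real.sin (d 1 + d 2)⟩
  side₃ : F (P 0 - P 3) = ⟨ℓ 3 * Real.sin (d 0), -(ℓ 3 * Real.cos (d 0))⟩
  sum : d 0 + d 1 + d 2 + d 3 = 0
  small : ∀ i, |d i| ≤ 0.0588
  pos : 0 < M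
  ge : ∀ i, 0.68 * M ≤ ℓ i
  le : ∀ i, ℓ i ≤ 0.74 * M

section Quad

variable {R : Set Plane} {F : Frame} {P : Fin 4 → Plane} {ℓ d : Fin 4 → ℝ} {M : ℝ}

theorem Quad.rotate (Q : Quad F P ℓ d M) :
    Quad (F.rot (Real.pi / 2 - d 1)) (fun j => P (j + 1)) (fun j => ℓ (j + 1))
      (fun j => d (j + 1)) M := by
  have e0 : (0 + 1 : Fin 4) = 1 := rfl
  have e1 : (1 + 1 : Fin 4) = 2 := rfl
  have e2 : (2 + 1 : Fin 4) = 3 := rfl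
  have e3 : (3 + 1 : Fin 4) = 0 := rfl
  have h23 : d 2 + d 3 = -(d 0 + d 1) := by linarith [Q.sum]
  have h1 := Real.cos_sq_add_sin_sq (d 1)
  refine ⟨?_, ?_, ?_, ?_, ?_, ?_, fun i => Q.small _, Q.pos, fun i => Q.ge _, fun i => Q.le _⟩
  · have : CCW F fun j => P (j + 1) := by
      intro w
      have := Q.ccw (w + 1)
      rwa [add_right_comm w 1 2] at this
    exact this.rot _
  all_goals simp only [e0, e1, e2, e3, Frame.rot_apply, Real.cos_pi_div_two_sub,
    Real.sin_pi_div_two_sub, h23, Real.cos_neg, Real.sin_neg]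
  · rw [Q.side₁]
    apply Complex.ext
    · linear_combination ℓ 1 * h1
    · ring
  · rw [Q.side₂, Real.cos_add, Real.sin_add]
    apply Complex.ext
    · linear_combination ℓ 2 * Real.sin (d 2) * h1
    · linear_combination ℓ 2 * Real.cos (d 2) * h1
  · rw [Q.side₃, Real.cos_add, Real.sin_add]
    apply Complex.ext <;> ring
  · rw [Q.side₀]
    apply Complex.ext <;> ring
  · linarith [Q.sum]

theorem Quad.exists_rotate (Q : Quad F P ℓ d M) (i : Fin 4) :
    ∃ F', Quad F' (fun j => P (j + i)) (fun j => ℓ (j + i)) (fun j => d (j + i)) M := by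
  have key : ∀ n : ℕ, ∃ F', Quad F' (fun j => P (j + Fin.ofNat 4 n))
      (fun j => ℓ (j + Fin.ofNat 4 n)) (fun j => d (j + Fin.ofNat 4 n)) M := by
    intro n
    induction n with
    | zero => exact ⟨F, by simpa using Q⟩
    | succ n ih =>
      obtain ⟨F', h⟩ := ih
      have e : ∀ j : Fin 4, j + 1 + Fin.ofNat 4 n = j + Fin.ofNat 4 (n + 1) := by
        intro j
        apply Fin.ext
        simp [Fin.val_add, Fin.ofNat]
        lia
      refine ⟨_, by simpa only [e] using h.rotate⟩
  obtain ⟨F', h⟩ := key i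
  have : Fin.ofNat 4 (i : ℕ) = i := by simp
  rw [this] at h
  exact ⟨F', h⟩

theorem Quad.corner (Q : Quad F P ℓ d M) : Corner F P (ℓ 0) (ℓ 3) (ℓ 1) (d 0) (d 1) := by
  have hM := Q.pos
  have h0 := Q.ge 0
  have h0' := Q.le 0
  refine ⟨Q.ccw, Q.side₀, ?_, Q.side₁, by linarith, by linarith [Q.ge 3], by linarith [Q.ge 1],
    Q.small 0, Q.small 1⟩
  rw [← neg_sub, map_neg, Q.side₃]
  simp [Complex.ext_iff]

theorem exists_polar {x y : ℝ} (hx : 0 < x) (h₁ : 0.8 * x ≤ y) (h₂ : y ≤ 1.25 * x) :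
    ∃ r α : ℝ, 0 < r ∧ α ∈ Set.Icc 0.5 1.05 ∧ x = r * Real.cos α ∧ y = r * Real.sin α := by
  have hy : 0 < y := by linarith
  set z : ℂ := ⟨x, y⟩ with hz
  have hz0 : z ≠ 0 := fun h => hx.ne' (congrArg Complex.re h)
  have hr : 0 < ‖z‖ := norm_pos_iff.2 hz0
  have hxr : x = ‖z‖ * Real.cos z.arg := (Complex.norm_mul_cos_arg z).symm
  have hyr : y = ‖z‖ * Real.sin z.arg := (Complex.norm_mul_sin_arg z).symm
  have π3 := Real.pi_gt_three
  have π4 := Real.pi_lt_d2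
  have h0 : 0 ≤ z.arg := Complex.arg_nonneg_iff.2 hy.le
  have h1 : |z.arg| ≤ Real.pi / 2 := Complex.abs_arg_le_pi_div_two_iff.2 hx.le
  have h1 := (abs_le.1 h1).2
  set α := z.arg
  have hcs : 0.8 * Real.cos α ≤ Real.sin α := by
    rw [hxr, hyr] at h₁
    nlinarith
  have hsc : Real.sin α ≤ 1.25 * Real.cos α := by
    rw [hxr, hyr] at h₂
    nlinarith
  refine ⟨‖z‖, α, hr, ⟨?_, ?_⟩, hxr, hyr⟩
  · by_contra! h
    -- For α < 0.5 the elementary bounds on sine and cosine force the slope below 0.8. The other end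
    -- follows in the same way from the complementary angle.
    have c1 := Real.one_sub_sq_div_two_le_cos (x := α)
    have c2 := Real.sin_le h0
    nlinarith
  · by_contra! h
    have c1 := Real.one_sub_sq_div_two_le_cos (x := Real.pi / 2 - α)
    have c2 := Real.sin_le (x := Real.pi / 2 - α) (by linarith)
    rw [Real.cos_pi_div_two_sub] at c1
    rw [Real.sin_pi_div_two_sub] at c2
    nlinarith

/-- The free parameter α is the angle between side `0` and the diagonal; the others follow from the
interior angles. Its range [0.5, 1.05], widened by two defects of 0.0588, fits into [0.38, 1.17]. -/
theorem Quad.exists_diag (Q : Quad F P ℓ d M) :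
    ∃ F' M' α, Diag F' P M' (ℓ 0) (ℓ 1) (ℓ 2) (ℓ 3) α (Real.pi / 2 + d 0 - α)
      (Real.pi / 2 - d 1 - α) (α + d 1 + d 2) := by
  have hM := Q.pos
  have s0 := abs_le.1 (Q.small 0)
  have s1 := abs_le.1 (Q.small 1)
  have s2 := abs_le.1 (Q.small 2)
  have g0 := Q.ge 0
  have g1 := Q.ge 1
  have g2 := Q.ge 2
  have g3 := Q.ge 3
  have l0 := Q.le 0
  have l1 := Q.le 1
  have c1 : 0.998 ≤ Real.cos (d 1) := by
    have := Real.one_sub_sq_div_two_le_cos (x := d 1)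
    nlinarith
  have c1' := Real.cos_le_one (d 1)
  have t1 : |Real.sin (d 1)| ≤ 0.0588 := Real.abs_sin_le_abs.trans (Q.small 1)
  have t1 := abs_le.1 t1
  have hℓ1 : 0 < ℓ 1 := by linarith
  have a1 : ℓ 1 * Real.sin (d 1) ≤ ℓ 1 * 0.0588 := by gcongr; exact t1.2
  have a2 : ℓ 1 * (-0.0588) ≤ ℓ 1 * Real.sin (d 1) := by gcongr; exact t1.1
  have a3 : ℓ 1 * 0.998 ≤ ℓ 1 * Real.cos (d 1) := by gcongr
  have a4 : ℓ 1 * Real.cos (d 1) ≤ ℓ 1 * 1 := by gcongr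
  obtain ⟨r, α, hr, hα, hx, hy⟩ := exists_polar (x := ℓ 0 + ℓ 1 * Real.sin (d 1))
    (y := ℓ 1 * Real.cos (d 1)) (by linarith) (by linarith) (by linarith)
  -- A crude bound of the diagonal by the sum of its coordinates suffices: 0.4 · 1.53 < 0.68.
  have hrM : r ≤ 1.53 * M := by
    have e : r = (r * Real.cos α) * Real.cos α + (r * Real.sin α) * Real.sin α := by
      linear_combination (-r) * Real.cos_sq_add_sin_sq α
    have e1 := mul_le_of_le_one_right (a := r * Real.cos α) (by rw [← hx]; linarith)
      (Real.cos_le_one α)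
    have e2 := mul_le_of_le_one_right (a := r * Real.sin α) (by rw [← hy]; linarith)
      (Real.sin_le_one α)
    linarith
  have π3 := Real.pi_gt_d2
  have π4 := Real.pi_lt_d2
  obtain ⟨hα1, hα2⟩ := hα
  have hcs := Real.cos_sq_add_sin_sq α
  refine ⟨F.rot α, r, α, Q.ccw.rot α, ?_, ?_, ?_, ?_, ?_, hr, by linarith, by linarith,
    by linarith, by linarith, ⟨by linarith, by linarith⟩, ⟨by linarith, by linarith⟩,
    ⟨by linarith, by linarith⟩, ⟨by linarith, by linarith⟩⟩
  · have : F (P 2 - P 0) = ⟨r * Real.cos α, r * Real.sin α⟩ := by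
      rw [← hx, ← hy, ← sub_add_sub_cancel (P 2) (P 1) (P 0), map_add, Q.side₁, Q.side₀]
      apply Complex.ext <;> simp [add_comm]
    rw [Frame.rot_apply, this]
    apply Complex.ext
    · linear_combination r * hcs
    · ring
  · rw [Frame.rot_apply, Q.side₀]
    apply Complex.ext <;> ring
  · rw [Frame.rot_apply, Q.side₁, show Real.pi / 2 - d 1 - α = Real.pi / 2 - (d 1 + α) by ring,
      Real.cos_pi_div_two_sub, Real.sin_pi_div_two_sub, Real.sin_add, Real.cos_add]
    apply Complex.ext <;> ring
  · rw [Frame.rot_apply, Q.side₂, add_assoc, Real.cos_add α, Real.sin_add α]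
    apply Complex.ext <;> ring
  · rw [Frame.rot_apply, Q.side₃, show Real.pi / 2 + d 0 - α = Real.pi / 2 - (α - d 0) by ring,
      Real.cos_pi_div_two_sub, Real.sin_pi_div_two_sub, Real.sin_sub, Real.cos_sub]
    apply Complex.ext <;> ring

theorem Quad.hasLoop_adjacent (Q : Quad F P ℓ d M) (hR : Chords R P) (h₀ : d 0 < 0)
    (h₁ : 2 * d 1 ≤ -d 0) : HasLoop R P 28 := by
  have C := Q.corner
  rw [← neg_neg (d 0)] at C
  rcases lt_trichotomy (d 1) 0 with h | h | h
  · rw [← neg_neg (d 1)] at C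
    exact (C.hasLoop_acute_acute hR (by linarith) (by linarith)).mono (by norm_num)
  · rw [h] at C
    exact (C.hasLoop_acute_right hR (by linarith)).mono (by norm_num)
  · exact C.hasLoop_acute_obtuse hR h h₁

theorem Quad.hasLoop_adjacent' (Q : Quad F P ℓ d M) (hR : Chords R P) (h₁ : d 1 < 0)
    (h₀ : 2 * d 0 ≤ -d 1) : HasLoop R P 28 := by
  have C := Q.corner.mirror
  have hR' := hR.of_sidesOf_reflect 1
  refine HasLoop.of_sidesOf (sidesOf_reflect P 1) ?_
  rw [← neg_neg (d 1)] at C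
  rcases lt_trichotomy (d 0) 0 with h | h | h
  · rw [← neg_neg (d 0)] at C
    exact (C.hasLoop_acute_acute hR' (by linarith) (by linarith)).mono (by norm_num)
  · rw [h] at C
    exact (C.hasLoop_acute_right hR' (by linarith)).mono (by norm_num)
  · exact C.hasLoop_acute_obtuse hR' h h₀

theorem Chords.rotate (hR : Chords R P) (i : Fin 4) : Chords R fun j => P (j + i) := by
  intro w w' hw x hx y hy
  simp only [side, add_right_comm] at hx hy
  exact hR (w + i) (w' + i) (by simpa using hw) x hx y hy

theorem Quad.hasLoop_of_neg (Q : Quad F P ℓ d M) (hR : Chords R P) (h₀ : d 0 < 0) :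
    HasLoop R P 28 := by
  have s := Q.sum
  have s0 := abs_le.1 (Q.small 0)
  have s2 := abs_le.1 (Q.small 2)
  by_cases h2 : d 2 < 0
  · obtain ⟨F', M', α, D⟩ := Q.exists_diag
    exact (D.hasLoop (a := -d 0) (c := -d 2) hR (by linarith) (by linarith) (by linarith)
      (by linarith) (by ring) (by ring)).mono (by norm_num)
  by_cases h1 : 2 * d 1 ≤ -d 0
  · exact Q.hasLoop_adjacent hR h₀ h1
  · obtain ⟨F', Q'⟩ := Q.exists_rotate 3
    refine HasLoop.of_sidesOf (sidesOf_rotate P 3) (Q'.hasLoop_adjacent' (hR.rotate 3) ?_ ?_)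
    · simpa using h₀
    · show 2 * d 3 ≤ -d 0
      -- Since d 2 ≥ 0 and the sum is zero, d 1 + d 3 ≤ -d 0. As 2 d 1 exceeds -d 0, the other
      -- neighbour satisfies the bound.
      linarith

/-- Every quadrilateral close to a square has a closed billiard trajectory with at most 28
bounces. -/
theorem Quad.hasLoop (Q : Quad F P ℓ d M) (hR : Chords R P) : HasLoop R P 28 := by
  by_cases h : ∃ i, d i < 0
  · obtain ⟨i, hi⟩ := h
    obtain ⟨F', Q'⟩ := Q.exists_rotate i
    exact HasLoop.of_sidesOf (sidesOf_rotate P i)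
      (Q'.hasLoop_of_neg (hR.rotate i) (by simpa using hi))
  · push Not at h
    have s := Q.sum
    have C := Q.corner
    rw [show d 0 = 0 by linarith [h 0, h 1, h 2, h 3],
      show d 1 = 0 by linarith [h 0, h 1, h 2, h 3]] at C
    exact (C.hasLoop_right_right hR).mono (by norm_num)

end Quad

/-! ### Chords stay in the interior of the table -/

section Inside

variable {F : Frame} {P : Fin 4 → Plane}

/-- The region cut out by the lines through the sides of a convex quadrilateral. -/
def innerRegion (F : Frame) (P : Fin 4 → Plane) : Set Plane :=
  {p | ∀ w, 0 < cr F (P (w + 1) - P w) (p - P w)}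

theorem isOpen_innerRegion : IsOpen (innerRegion F P) := by
  simp only [innerRegion, Set.ofPred_forall]
  refine isOpen_iInter_of_finite fun w => isOpen_lt continuous_const ?_
  have h : Continuous fun p => F (p - P w) := F.continuous.comp (continuous_id.sub continuous_const)
  exact (continuous_const.mul (Complex.continuous_im.comp h)).sub
    (continuous_const.mul (Complex.continuous_re.comp h))

theorem CCW.chord_subset (hP : CCW F P) : Chords (innerRegion F P) P := by
  intro w w' hw x hx y hy p hp v
  have key : ∀ {w x}, x ∈ side P w → 0 ≤ cr F (P (v + 1) - P v) (x - P v) ∧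
      (w ≠ v → 0 < cr F (P (v + 1) - P v) (x - P v)) := by
    intro w x hx
    refine ⟨?_, fun h => hP.cr_pos h hx⟩
    rcases eq_or_ne w v with rfl | h
    · have := cr_side (F := F) x hx x
      rw [← this, sub_self]
      simp [cr]
    · exact (hP.cr_pos h hx).le
  obtain ⟨a, b, ha, hb, hab, rfl⟩ := hp
  have e : cr F (P (v + 1) - P v) (a • x + b • y - P v) =
      a * cr F (P (v + 1) - P v) (x - P v) + b * cr F (P (v + 1) - P v) (y - P v) := by
    obtain rfl : a = 1 - b := by linarith
    simp only [cr, map_sub, map_add, map_smul, Complex.sub_re, Complex.sub_im, Complex.add_re,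
      Complex.add_im, Complex.smul_re, Complex.smul_im, smul_eq_mul]
    ring
  rw [e]
  rcases eq_or_ne w v with rfl | h
  · exact add_pos_of_nonneg_of_pos (mul_nonneg ha.le (key hx).1) (mul_pos hb ((key hy).2 hw.symm))
  · exact add_pos_of_pos_of_nonneg (mul_pos ha ((key hx).2 h)) (mul_nonneg hb.le (key hy).1)

/-- The three cross products divided by `cr F (B - A) (C - A)` are the barycentric coordinates of
`p`. -/
theorem mem_triangle {A B C p : Plane} (hD : 0 < cr F (B - A) (C - A))
    (h₁ : 0 ≤ cr F (B - A) (p - A)) (h₂ : 0 ≤ cr F (C - B) (p - B))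
    (h₃ : 0 ≤ cr F (A - C) (p - C)) : p ∈ convexHull ℝ {A, B, C} := by
  set D := cr F (B - A) (C - A) with hD'
  set s := cr F (B - A) (p - A) with hs
  set t := cr F (C - B) (p - B) with ht
  set u := cr F (A - C) (p - C) with hu
  simp only [cr, map_sub, Complex.sub_re, Complex.sub_im] at hD' hs ht hu
  have hsum : t + u + s = D := by rw [hD', hs, ht, hu]; ring
  have hp : p = (t / D) • A + (u / D) • B + (s / D) • C := by
    apply F.injective
    simp only [map_add, map_smul]
    apply Complex.ext
    · simp only [Complex.add_re, Complex.smul_re, smul_eq_mul]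
      field_simp
      rw [hD', hs, ht, hu]
      ring
    · simp only [Complex.add_im, Complex.smul_im, smul_eq_mul]
      field_simp
      rw [hD', hs, ht, hu]
      ring
  have := (convex_convexHull ℝ {A, B, C}).sum_mem (t := Finset.univ)
    (w := ![t / D, u / D, s / D]) (z := ![A, B, C])
    (by intro i _; fin_cases i <;> simp <;> positivity)
    (by simp only [Fin.sum_univ_three, Matrix.cons_val]; rw [← add_div, ← add_div, hsum, div_self hD.ne'])
    (by intro i _; apply subset_convexHull; fin_cases i <;> simp)
  rw [hp]
  simpa [Fin.sum_univ_three] using this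

theorem CCW.innerRegion_subset (hP : CCW F P) :
    innerRegion F P ⊆ convexHull ℝ {P 0, P 1, P 2} ∪ convexHull ℝ {P 0, P 2, P 3} := by
  intro p hp
  have h0 : 0 < cr F (P 1 - P 0) (p - P 0) := hp 0
  have h1 : 0 < cr F (P 2 - P 1) (p - P 1) := hp 1
  have h2 : 0 < cr F (P 3 - P 2) (p - P 2) := hp 2
  have h3 : 0 < cr F (P 0 - P 3) (p - P 3) := hp 3
  have hA : 0 < cr F (P 1 - P 0) (P 2 - P 0) := hP 0
  have hB : 0 < cr F (P 3 - P 2) (P 0 - P 2) := hP 2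
  have e : cr F (P 0 - P 2) (p - P 2) = -cr F (P 2 - P 0) (p - P 0) := by
    simp only [cr, map_sub, Complex.sub_re, Complex.sub_im]
    ring
  have e' : cr F (P 2 - P 0) (P 3 - P 0) = cr F (P 3 - P 2) (P 0 - P 2) := by
    simp only [cr, map_sub, Complex.sub_re, Complex.sub_im]
    ring
  rcases le_total 0 (cr F (P 0 - P 2) (p - P 2)) with h | h
  · exact Or.inl (mem_triangle hA h0.le h1.le h)
  · exact Or.inr (mem_triangle (by rwa [e']) (by linarith) h2.le h3.le)

theorem Chords.mono {R R' : Set Plane} (h : Chords R P) (hRR' : R ⊆ R') : Chords R' P :=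
  fun w w' hw x hx y hy => (h w w' hw x hx y hy).trans hRR'

end Inside

/-! ### From angle parameters to nearly square data -/

section NearSquare

theorem frame_angle {F : Frame} {v u : Plane} {M : ℝ} (hM : 0 < M) (hu : F u = ⟨M, 0⟩) :
    (F v).re = ‖v‖ * Real.cos (InnerProductGeometry.angle v u) ∧
      (0 ≤ (F v).im → (F v).im = ‖v‖ * Real.sin (InnerProductGeometry.angle v u)) ∧
      ((F v).im ≤ 0 → (F v).im = -(‖v‖ * Real.sin (InnerProductGeometry.angle v u))) := by
  have hn : ‖u‖ = M := by
    rw [← F.norm_map, hu]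
    have : (⟨M, 0⟩ : ℂ) = (M : ℂ) := rfl
    rw [this, Complex.norm_real, Real.norm_of_nonneg hM.le]
  have h1 : (F v).re = ‖v‖ * Real.cos (InnerProductGeometry.angle v u) := by
    have := InnerProductGeometry.cos_angle_mul_norm_mul_norm v u
    rw [hn, ← F.inner_map_map, hu, Complex.inner] at this
    simp at this
    have h2 : (‖v‖ * Real.cos (InnerProductGeometry.angle v u) - (F v).re) * M = 0 := by
      linarith
    rcases mul_eq_zero.1 h2 with h | h
    · linarith
    · exact absurd h hM.ne'
  have h2 : (F v).im ^ 2 = (‖v‖ * Real.sin (InnerProductGeometry.angle v u)) ^ 2 := by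
    have e : ‖v‖ ^ 2 = (F v).re ^ 2 + (F v).im ^ 2 := by
      rw [← F.norm_map, Complex.sq_norm, Complex.normSq_apply]
      ring
    have hcs := Real.cos_sq_add_sin_sq (InnerProductGeometry.angle v u)
    rw [h1] at e
    linear_combination (-‖v‖ ^ 2) * hcs - e
  have h3 : 0 ≤ ‖v‖ * Real.sin (InnerProductGeometry.angle v u) :=
    mul_nonneg (norm_nonneg _) (InnerProductGeometry.sin_angle_nonneg _ _)
  refine ⟨h1, fun h => (sq_eq_sq₀ h h3).1 h2, fun h => ?_⟩
  have := (sq_eq_sq₀ (neg_nonneg.2 h) h3).1 (by rw [neg_sq, h2])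
  linarith

/-- A frame adapted to a splitting diagonal. -/
theorem exists_frame_of_isSplittingDiagonal {P : Fin 4 → Plane} (h : IsSplittingDiagonal P 0) :
    ∃ (F : Frame) (M : ℝ), 0 < M ∧ F (P 2 - P 0) = ⟨M, 0⟩ ∧ (F (P 1 - P 0)).im < 0 ∧
      0 < (F (P 3 - P 0)).im := by
  obtain ⟨hne, hopp⟩ := h
  change P 0 ≠ P 2 at hne
  change (line[ℝ, P 0, P 2]).SOppSide (P 1) (P 3) at hopp
  set B : Frame := Complex.orthonormalBasisOneI.repr.symm
  set z := B (P 2 - P 0) with hz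
  have hz0 : 0 < ‖z‖ := by
    rw [hz, B.norm_map, norm_pos_iff]
    exact sub_ne_zero.2 hne.symm
  set F := B.rot z.arg with hF
  have hF2 : F (P 2 - P 0) = ⟨‖z‖, 0⟩ := by
    have e1 := Complex.norm_mul_cos_arg z
    have e2 := Complex.norm_mul_sin_arg z
    have hcs := Real.cos_sq_add_sin_sq z.arg
    rw [hF, Frame.rot_apply, ← hz]
    apply Complex.ext
    · simp only
      rw [← e1, ← e2]
      linear_combination ‖z‖ * hcs
    · simp only
      rw [← e1, ← e2]
      ring
  have hmem : ∀ p, p ∈ line[ℝ, P 0, P 2] ↔ ∃ r : ℝ, r • (P 2 - P 0) = p - P 0 := by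
    intro p
    rw [← vsub_eq_sub (P 2), ← vadd_left_mem_affineSpan_pair, vadd_eq_add, sub_add_cancel]
  have hline : ∀ p ∈ line[ℝ, P 0, P 2], (F (p - P 0)).im = 0 := by
    intro p hp
    obtain ⟨r, hr⟩ := (hmem p).1 hp
    rw [← hr, map_smul, hF2]
    simp
  have hline' : ∀ p ∉ line[ℝ, P 0, P 2], (F (p - P 0)).im ≠ 0 := by
    intro p hp h0
    apply hp
    refine (hmem p).2 ⟨(F (p - P 0)).re / ‖z‖, ?_⟩
    apply F.injective
    rw [map_smul, hF2]
    apply Complex.ext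
    · simp [hz0.ne']
    · rw [h0]
      simp
  obtain ⟨⟨p₁, hp₁, p₂, hp₂, hray⟩, h1, h3⟩ := hopp
  have hmul : (F (P 1 - P 0)).im * (F (P 3 - P 0)).im ≤ 0 := by
    have e1 : (F (P 1 - p₁)).im = (F (P 1 - P 0)).im := by
      have := hline p₁ hp₁
      simp only [map_sub, Complex.sub_im] at this ⊢
      linarith
    have e2 : (F (p₂ - P 3)).im = -(F (P 3 - P 0)).im := by
      have := hline p₂ hp₂
      simp only [map_sub, Complex.sub_im] at this ⊢
      linarith
    obtain ⟨a, b, ha, hb, -, hv1, hv2⟩ := hray.exists_eq_smul_add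
    simp only [vsub_eq_sub] at hv1 hv2
    have f1 : (F (P 1 - P 0)).im = a * (F (P 1 - p₁ + (p₂ - P 3))).im := by
      rw [← e1]
      nth_rw 1 [hv1]
      rw [map_smul, Complex.smul_im, smul_eq_mul]
    have f2 : -(F (P 3 - P 0)).im = b * (F (P 1 - p₁ + (p₂ - P 3))).im := by
      rw [← e2]
      nth_rw 1 [hv2]
      rw [map_smul, Complex.smul_im, smul_eq_mul]
    have : (F (P 1 - P 0)).im * -(F (P 3 - P 0)).im =
        (a * b) * (F (P 1 - p₁ + (p₂ - P 3))).im ^ 2 := by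
      rw [f1, f2]; ring
    nlinarith [mul_nonneg (mul_nonneg ha hb) (sq_nonneg (F (P 1 - p₁ + (p₂ - P 3))).im)]
  have g1 := hline' _ h1
  have g3 := hline' _ h3
  -- A clockwise quadrilateral is handled by reversing the orientation of the frame.
  rcases lt_or_gt_of_ne g3 with h | h
  · refine ⟨F.mirror.neg, ‖z‖, hz0, ?_, ?_, ?_⟩
    · simp [Frame.neg_apply, Frame.mirror_apply, hF2, Complex.ext_iff]
    · have : 0 < (F (P 1 - P 0)).im := lt_of_le_of_ne (by nlinarith) g1.symm
      simpa [Frame.neg_apply, Frame.mirror_apply] using this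
    · simpa [Frame.neg_apply, Frame.mirror_apply] using h
  · exact ⟨F, ‖z‖, hz0, hF2, lt_of_le_of_ne (by nlinarith) g1, h⟩

end NearSquare

section NearSquare

theorem pi_div_107_lt : Real.pi / 107 < 0.02937 := by
  have := Real.pi_lt_d4
  linarith

/-- The law of sines in a triangle whose angles at the base are close to `π / 4`. -/
theorem side_bounds {r M a b : ℝ} (hM : 0 < M) (h : r * Real.sin (a + b) = M * Real.sin b)
    (ha : |a - Real.pi / 4| < Real.pi / 107) (hb : |b - Real.pi / 4| < Real.pi / 107) :
    0.68 * M ≤ r ∧ r ≤ 0.74 * M := by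
  have hε := pi_div_107_lt
  obtain ⟨ha1, ha2⟩ := abs_lt.1 ha
  obtain ⟨hb1, hb2⟩ := abs_lt.1 hb
  set x := b - Real.pi / 4 with hx
  have hs : Real.sin (a + b) = Real.cos (a + b - Real.pi / 2) := by
    rw [Real.cos_sub_pi_div_two]
  have h1 : 0.998 ≤ Real.sin (a + b) := by
    rw [hs]
    have := Real.one_sub_sq_div_two_le_cos (x := a + b - Real.pi / 2)
    have : (a + b - Real.pi / 2) ^ 2 ≤ 0.05874 ^ 2 := sq_le_sq' (by linarith) (by linarith)
    linarith
  have h2 : Real.sin b = √2 / 2 * (Real.cos x + Real.sin x) := by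
    rw [show b = Real.pi / 4 + x by rw [hx]; ring, Real.sin_add, Real.sin_pi_div_four,
      Real.cos_pi_div_four]
    ring
  have c1 : 0.9995 ≤ Real.cos x := by
    have := Real.one_sub_sq_div_two_le_cos (x := x)
    have : x ^ 2 ≤ 0.02937 ^ 2 := sq_le_sq' (by linarith) (by linarith)
    linarith
  have c2 := Real.cos_le_one x
  have c3 := abs_le.1 ((Real.abs_sin_le_abs (x := x)).trans (hb.le.trans hε.le))
  have q1 : 1.4142 ≤ √2 := Real.le_sqrt_of_sq_le (by norm_num)
  have q2 : √2 ≤ 1.4143 := Real.sqrt_le_iff.2 ⟨by norm_num, by norm_num⟩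
  have b1 : 0.685 ≤ Real.sin b := by rw [h2]; nlinarith
  have b2 : Real.sin b ≤ 0.7285 := by rw [h2]; nlinarith
  have b3 := Real.sin_le_one (a + b)
  have hr : 0 < r := by
    have : 0 < r * Real.sin (a + b) := by rw [h]; positivity
    exact pos_of_mul_pos_left this (by linarith)
  constructor
  · nlinarith
  · nlinarith

/-- Each defect is the sum of two deviations from π/4 up to sign, so it is below 2π/107 < 0.0588.
The angles at the diagonal's ends stay below π, which makes the figure convex. The law of sines
bounds the sides. -/
theorem exists_quad {P : Fin 4 → Plane} (h : IsSplittingDiagonal P 0) {a₁ a₂ a₃ a₄ : ℝ}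
    (h₁ : EuclideanGeometry.angle (P 1) (P 0) (P 2) = a₁)
    (h₂ : EuclideanGeometry.angle (P 1) (P 2) (P 0) = a₂)
    (h₃ : EuclideanGeometry.angle (P 3) (P 2) (P 0) = a₃)
    (h₄ : EuclideanGeometry.angle (P 3) (P 0) (P 2) = a₄)
    (h₁' : |a₁ - Real.pi / 4| < Real.pi / 107) (h₂' : |a₂ - Real.pi / 4| < Real.pi / 107)
    (h₃' : |a₃ - Real.pi / 4| < Real.pi / 107) (h₄' : |a₄ - Real.pi / 4| < Real.pi / 107) :
    ∃ F ℓ d M, Quad F P ℓ d M := by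
  obtain ⟨F, M, hM, hF, hF1, hF3⟩ := exists_frame_of_isSplittingDiagonal h
  have hε := pi_div_107_lt
  have π3 := Real.pi_gt_d2
  have π4 := Real.pi_lt_d2
  have hFn : F.neg (P 0 - P 2) = ⟨M, 0⟩ := by
    rw [Frame.neg_apply, ← map_neg, neg_sub, hF]
  have hF1' : (F (P 1 - P 2)).im = (F (P 1 - P 0)).im := by
    simp only [map_sub, Complex.ext_iff, Complex.sub_im, Complex.sub_re] at hF ⊢
    linarith [hF.2]
  have hF3' : (F (P 3 - P 2)).im = (F (P 3 - P 0)).im := by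
    simp only [map_sub, Complex.ext_iff, Complex.sub_im, Complex.sub_re] at hF ⊢
    linarith [hF.2]
  obtain ⟨x1, -, y1⟩ := frame_angle (v := P 1 - P 0) hM hF
  obtain ⟨x2, y2, -⟩ := frame_angle (v := P 1 - P 2) hM hFn
  obtain ⟨x3, -, y3⟩ := frame_angle (v := P 3 - P 2) hM hFn
  obtain ⟨x4, y4, -⟩ := frame_angle (v := P 3 - P 0) hM hF
  change InnerProductGeometry.angle (P 1 - P 0) (P 2 - P 0) = a₁ at h₁
  change InnerProductGeometry.angle (P 1 - P 2) (P 0 - P 2) = a₂ at h₂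
  change InnerProductGeometry.angle (P 3 - P 2) (P 0 - P 2) = a₃ at h₃
  change InnerProductGeometry.angle (P 3 - P 0) (P 2 - P 0) = a₄ at h₄
  rw [h₁] at x1 y1
  rw [h₂] at x2 y2
  rw [h₃] at x3 y3
  rw [h₄] at x4 y4
  rw [Frame.neg_apply, Complex.neg_re] at x2 x3
  rw [Frame.neg_apply, Complex.neg_im] at y2 y3
  replace y1 := y1 hF1.le
  replace y2 := y2 (by linarith)
  replace y3 := y3 (by linarith)
  replace y4 := y4 hF3.le
  set r₁ := ‖P 1 - P 0‖
  set r₂ := ‖P 1 - P 2‖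
  set r₃ := ‖P 3 - P 2‖
  set r₄ := ‖P 3 - P 0‖
  obtain ⟨l1, u1⟩ := abs_lt.1 h₁'
  obtain ⟨l2, u2⟩ := abs_lt.1 h₂'
  obtain ⟨l3, u3⟩ := abs_lt.1 h₃'
  obtain ⟨l4, u4⟩ := abs_lt.1 h₄'
  have hFF := hF
  simp only [map_sub, Complex.ext_iff, Complex.sub_im, Complex.sub_re] at x1 x2 x3 x4 y1 y2 y3 y4 hFF
  have m12 : r₁ * Real.cos a₁ + r₂ * Real.cos a₂ = M := by linarith [hFF.1]
  have n12 : r₁ * Real.sin a₁ = r₂ * Real.sin a₂ := by linarith [hFF.2]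
  have m34 : r₃ * Real.cos a₃ + r₄ * Real.cos a₄ = M := by linarith [hFF.1]
  have n34 : r₃ * Real.sin a₃ = r₄ * Real.sin a₄ := by linarith [hFF.2]
  have b1 := side_bounds (r := r₁) hM
    (by rw [Real.sin_add]; linear_combination Real.sin a₂ * m12 + Real.cos a₂ * n12) h₁' h₂'
  have b2 := side_bounds (r := r₂) hM
    (by rw [Real.sin_add]; linear_combination Real.sin a₁ * m12 - Real.cos a₁ * n12) h₂' h₁'
  have b3 := side_bounds (r := r₃) hM
    (by rw [Real.sin_add]; linear_combination Real.sin a₄ * m34 + Real.cos a₄ * n34) h₃' h₄'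
  have b4 := side_bounds (r := r₄) hM
    (by rw [Real.sin_add]; linear_combination Real.sin a₃ * m34 - Real.cos a₃ * n34) h₄' h₃'
  have hr1 : 0 < r₁ := by linarith [b1.1]
  have hr2 : 0 < r₂ := by linarith [b2.1]
  have hr3 : 0 < r₃ := by linarith [b3.1]
  have hr4 : 0 < r₄ := by linarith [b4.1]
  have s1 : 0 < Real.sin a₁ := Real.sin_pos_of_pos_of_lt_pi (by linarith) (by linarith)
  have s3 : 0 < Real.sin a₃ := Real.sin_pos_of_pos_of_lt_pi (by linarith) (by linarith)
  have s23 : 0 < Real.sin (a₂ + a₃) := Real.sin_pos_of_pos_of_lt_pi (by linarith) (by linarith)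
  have s14 : 0 < Real.sin (a₁ + a₄) := Real.sin_pos_of_pos_of_lt_pi (by linarith) (by linarith)
  have e1 : F (P 1 - P 0) = ⟨r₁ * Real.cos a₁, -(r₁ * Real.sin a₁)⟩ := by
    rw [map_sub]; exact Complex.ext x1 y1
  have e2 : F (P 2 - P 1) = ⟨r₂ * Real.cos a₂, r₂ * Real.sin a₂⟩ := by
    rw [map_sub]; apply Complex.ext <;> simp only [Complex.sub_re, Complex.sub_im] <;> linarith
  have e3 : F (P 3 - P 2) = ⟨-(r₃ * Real.cos a₃), r₃ * Real.sin a₃⟩ := by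
    rw [map_sub]; apply Complex.ext <;> simp only [Complex.sub_re, Complex.sub_im] <;> linarith
  have e4 : F (P 0 - P 3) = ⟨-(r₄ * Real.cos a₄), -(r₄ * Real.sin a₄)⟩ := by
    rw [map_sub]; apply Complex.ext <;> simp only [Complex.sub_re, Complex.sub_im] <;> linarith
  have hccw : CCW F P := by
    have f1 : F (P 3 - P 1) = F (P 3 - P 2) + F (P 2 - P 1) := by
      rw [← map_add, sub_add_sub_cancel]
    have f2 : F (P 1 - P 3) = F (P 1 - P 0) + F (P 0 - P 3) := by
      rw [← map_add, sub_add_sub_cancel]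
    have f3 : F (P 0 - P 2) = -F (P 2 - P 0) := by rw [← map_neg, neg_sub]
    intro w
    fin_cases w
    · change 0 < cr F (P 1 - P 0) (P 2 - P 0)
      rw [cr, e1, hF]
      have : 0 < r₁ * Real.sin a₁ * M := by positivity
      simp only
      linarith
    · change 0 < cr F (P 2 - P 1) (P 3 - P 1)
      rw [cr, f1, e2, e3]
      have : 0 < r₂ * r₃ * Real.sin (a₂ + a₃) := by positivity
      rw [Real.sin_add] at this
      simp only [Complex.add_re, Complex.add_im]
      linarith
    · change 0 < cr F (P 3 - P 2) (P 0 - P 2)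
      rw [cr, f3, e3, hF]
      have : 0 < r₃ * Real.sin a₃ * M := by positivity
      simp only [Complex.neg_re, Complex.neg_im]
      linarith
    · change 0 < cr F (P 0 - P 3) (P 1 - P 3)
      rw [cr, f2, e1, e4]
      have : 0 < r₁ * r₄ * Real.sin (a₁ + a₄) := by positivity
      rw [Real.sin_add] at this
      simp only [Complex.add_re, Complex.add_im]
      linarith
  -- Side `0` has direction angle -a₁ relative to the diagonal, so this rotation makes it the first
  -- axis.
  refine ⟨F.rot (-a₁), ![r₁, r₂, r₃, r₄], ![a₁ + a₄ - Real.pi / 2, Real.pi / 2 - a₁ - a₂,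
    a₂ + a₃ - Real.pi / 2, Real.pi / 2 - a₃ - a₄], M, hccw.rot _, ?_, ?_, ?_, ?_, ?_, ?_, hM, ?_,
    ?_⟩
  · have := Real.cos_sq_add_sin_sq a₁
    rw [Frame.rot_apply, e1, Real.cos_neg, Real.sin_neg]
    apply Complex.ext
    · simp only [Matrix.cons_val]
      linear_combination r₁ * this
    · simp only
      ring
  · rw [Frame.rot_apply, e2, Real.cos_neg, Real.sin_neg]
    simp only [Matrix.cons_val]
    rw [sub_sub, Real.sin_pi_div_two_sub, Real.cos_pi_div_two_sub, Real.sin_add, Real.cos_add]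
    apply Complex.ext <;> ring
  · rw [Frame.rot_apply, e3, Real.cos_neg, Real.sin_neg]
    simp only [Matrix.cons_val]
    rw [show Real.pi / 2 - a₁ - a₂ + (a₂ + a₃ - Real.pi / 2) = a₃ - a₁ by ring, Real.sin_sub,
      Real.cos_sub]
    apply Complex.ext <;> ring
  · rw [Frame.rot_apply, e4, Real.cos_neg, Real.sin_neg]
    simp only [Matrix.cons_val]
    rw [Real.sin_sub_pi_div_two, Real.cos_sub_pi_div_two, Real.sin_add, Real.cos_add]
    apply Complex.ext <;> ring
  · simp only [Matrix.cons_val]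
    ring
  · intro i
    fin_cases i <;> simp only [Matrix.cons_val, Fin.reduceFinMk] <;>
      exact abs_le.2 ⟨by linarith, by linarith⟩
  · intro i
    fin_cases i
    exacts [b1.1, b2.1, b3.1, b4.1]
  · intro i
    fin_cases i
    exacts [b1.2, b2.2, b3.2, b4.2]

theorem Quadrilateral.IsNearSquare.hasLoop {q : Quadrilateral}
    (h : q.IsNearSquare (Real.pi / 107)) : HasLoop (interior q.table) q.vertex 28 := by
  obtain ⟨i, hi, ha⟩ := h
  have c0 : ∀ j, j + i = i + j := fun j => add_comm j i
  obtain ⟨F, ℓ, d, M, Q⟩ := exists_quad (P := fun j => q.vertex (j + i))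
    (a₁ := q.angleParam i 0) (a₂ := q.angleParam i 1) (a₃ := q.angleParam i 2)
    (a₄ := q.angleParam i 3)
    (by
      simp only [IsSplittingDiagonal, zero_add, c0] at hi ⊢
      simpa using hi)
    (by simp [Quadrilateral.angleParam, c0]) (by simp [Quadrilateral.angleParam, c0])
    (by simp [Quadrilateral.angleParam, c0]) (by simp [Quadrilateral.angleParam, c0])
    (ha 0) (ha 1) (ha 2) (ha 3)
  refine HasLoop.of_sidesOf (sidesOf_rotate q.vertex i) (Q.hasLoop ?_)
  -- The region bounded by the four side lines is open and contained in the table, hence in its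
  -- interior.
  refine Q.ccw.chord_subset.mono (interior_maximal (fun p hp => ?_) isOpen_innerRegion)
  have := Q.ccw.innerRegion_subset hp
  simp only [c0, add_zero] at this
  exact ⟨i, hi, this⟩

end NearSquare

theorem mainTheorem2 :
    (∃ 𝒲 : Finset (List (Fin 4)),
      {q : Quadrilateral | q.IsNearSquare (Real.pi / 107)} ⊆ ⋃ W ∈ 𝒲, orbitTile W) ∧
    (∀ q : Quadrilateral, q.IsNearSquare (Real.pi / 107) → q.HasPeriodicBilliardPath) := by
  -- 56 is twice the maximal number 28 of bounces.
  refine ⟨⟨(List.finite_length_le (Fin 4) 56).toFinset, fun q hq => ?_⟩, fun q hq => ?_⟩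
  · obtain ⟨W, hW, h⟩ := (Quadrilateral.IsNearSquare.hasLoop hq).exists_hasOrbitType
    exact Set.mem_biUnion (by simpa using hW) h
  · obtain ⟨W, -, h⟩ := hq.hasLoop.exists_hasOrbitType
    exact h.hasPeriodicBilliardPath
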